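/- Let $6\le n\le 8$ and let $G=E_n\subset O(\mathbb R^n)$ be the (essential, finite) real reflection group of type $E_n$, i.e. the group generated by the reflections in a basis of unit vectors $\alpha_1,\dots,\alpha_n$ of $\mathbb R^n$ with $\langle\alpha_i,\alpha_j\rangle=-\cos(\pi/m_{ij})$, where $(m_{ij})$ is the Coxeter matrix of type $E_n$. A set of basic invariants of $G$ is a family of algebraically independent homogeneous polynomials $\pi_1,\dots,\pi_n$ with $\deg\pi_1\le\dots\le\deg\pi_n$ that generate the ring $\mathbb R[x_1,\dots,x_n]^G$ of $G$-invariant polynomials. A $G$-invariant real variety $X\subseteq\mathbb R^n$ is called $k$-sparse if, for some choice of basic invariants $\pi_1,\dots,\pi_n$, there are finitely many $f_1,\dots,f_m\in\mathbb R[\pi_1,\dots,\pi_k]$ with $X=\{p\in\mathbb R^n: f_1(p)=\dots=f_m(p)=0\}$. A flat of $G$ is an intersection of a set of hyperplanes of reflections belonging to $G$ (the empty intersection being $\mathbb R^n$), and $\mathcal H_i(G)$ denotes the set of points that lie in some flat of dimension $i$. Then every nonempty $2$-sparse $E_n$-invariant real variety $X$ satisfies $X\cap\mathcal H_{n-2}(E_n)\ne\emptyset$.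 -/

import Mathlib

open scoped RealInnerProductSpace

/-- Euclidean `n`-space `V = ℝⁿ`. -/
abbrev EucSpace (n : ℕ) : Type := EuclideanSpace ℝ (Fin n)

/-- The orthogonal group `O(V)` of linear isometries of `V = ℝⁿ`. -/
abbrev OrthGroup (n : ℕ) : Type := EucSpace n ≃ₗᵢ[ℝ] EucSpace n

/-- The linear hyperplane orthogonal to `v` (a hyperplane when `v ≠ 0`). -/
noncomputable abbrev hyperplaneOf {n : ℕ} (v : EucSpace n) : Submodule ℝ (EucSpace n) := (ℝ ∙ v)ᗮ

/-- The orthogonal reflection fixing the hyperplane `v^⊥` pointwise and sending `v` to `-v`. -/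
noncomputable def reflectionAlong {n : ℕ} (v : EucSpace n) : OrthGroup n :=
  (hyperplaneOf v).reflection

/-- `G ⊆ O(ℝⁿ)` is the essential reflection group with Coxeter matrix `M`: it is generated by the
reflections in a system of simple roots, that is, a basis of unit vectors `α i` of `ℝⁿ` with
`⟪α i, α j⟫ = -cos (π / M i j)`.  (On the diagonal, `M i i = 1` gives `⟪α i, α i⟫ = 1`.) -/
def IsOfCoxeterType {n : ℕ} (M : CoxeterMatrix (Fin n)) (G : Subgroup (OrthGroup n)) : Prop :=
  ∃ α : Fin n → EucSpace n,
    LinearIndependent ℝ α ∧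
    (∀ i j, ⟪α i, α j⟫ = -Real.cos (Real.pi / (M i j : ℝ))) ∧
    G = Subgroup.closure (Set.range fun i => reflectionAlong (α i))

/-- `G ⊆ O(ℝⁿ)` is the reflection group of type `E_n` (which exists for `n = 6, 7, 8` only). -/
def IsTypeE : {n : ℕ} → Subgroup (OrthGroup n) → Prop
  | 6, G => IsOfCoxeterType CoxeterMatrix.E₆ G
  | 7, G => IsOfCoxeterType CoxeterMatrix.E₇ G
  | 8, G => IsOfCoxeterType CoxeterMatrix.E₈ G
  | _, _ => False

/-- The reflection arrangement `ℋ(G)`: the hyperplanes of all reflections belonging to `G`. -/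
def reflectionArrangement {n : ℕ} (G : Subgroup (OrthGroup n)) :
    Set (Submodule ℝ (EucSpace n)) :=
  {H | ∃ v : EucSpace n, v ≠ 0 ∧ reflectionAlong v ∈ G ∧ H = hyperplaneOf v}

/-- The flats of the arrangement: all intersections of hyperplanes in `ℋ(G)`; the empty
intersection is the whole space. -/
def arrangementFlats {n : ℕ} (G : Subgroup (OrthGroup n)) : Set (Submodule ℝ (EucSpace n)) :=
  {L | ∃ A : Set (Submodule ℝ (EucSpace n)), A ⊆ reflectionArrangement G ∧ L = sInf A}

/-- The stratum `ℋ_i(G)`: the points that lie in some flat of dimension `i`. -/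
def stratum {n : ℕ} (G : Subgroup (OrthGroup n)) (i : ℕ) : Set (EucSpace n) :=
  {p | ∃ L ∈ arrangementFlats G, Module.finrank ℝ L = i ∧ p ∈ L}

/-- The value of the polynomial `f` at the point `p` of `ℝⁿ`. -/
noncomputable def evalAt {n : ℕ} (p : EucSpace n) (f : MvPolynomial (Fin n) ℝ) : ℝ :=
  MvPolynomial.eval (fun i => p i) f

/-- The real variety `V_ℝ(f₁, …, f_m)`. -/
def realVariety {n m : ℕ} (f : Fin m → MvPolynomial (Fin n) ℝ) : Set (EucSpace n) :=
  {p | ∀ j, evalAt p (f j) = 0}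

/-- The ring `ℝ[V]^G` of polynomials invariant under `G`.  A real polynomial is determined by the
function it defines, so invariance is expressed through values. -/
def invariantRing {n : ℕ} (G : Subgroup (OrthGroup n)) :
    Subalgebra ℝ (MvPolynomial (Fin n) ℝ) where
  carrier := {f | ∀ g ∈ G, ∀ p : EucSpace n, evalAt (g p) f = evalAt p f}
  mul_mem' := by
    intro a b ha hb g hg p
    have h1 := ha g hg p
    have h2 := hb g hg p
    simp only [evalAt, map_mul] at *
    rw [h1, h2]
  add_mem' := by
    intro a b ha hb g hg p
    have h1 := ha g hg p
    have h2 := hb g hg p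
    simp only [evalAt, map_add] at *
    rw [h1, h2]
  algebraMap_mem' := by
    intro r g _ p
    simp [evalAt, MvPolynomial.algebraMap_eq]

/-- `π₁, …, π_n` (indexed by `Fin n`, starting from `0`) is a set of basic invariants for `G`:
algebraically independent homogeneous generators of `ℝ[V]^G`, labelled by increasing degree. -/
structure IsBasicInvariants {n : ℕ} (G : Subgroup (OrthGroup n))
    (π : Fin n → MvPolynomial (Fin n) ℝ) : Prop where
  homogeneous : ∀ i, (π i).IsHomogeneous (π i).totalDegree
  algebraicIndependent : AlgebraicIndependent ℝ π
  adjoin_eq : Algebra.adjoin ℝ (Set.range π) = invariantRing G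
  monotone_degree : Monotone fun i => (π i).totalDegree

/-- `X` is a `k`-sparse (`G`-invariant) real variety: `X = V_ℝ(f₁, …, f_m)` with
`f₁, …, f_m ∈ ℝ[π₁, …, π_k]` for some choice of basic invariants.  Such an `X` is automatically
`G`-invariant. -/
def IsSparse {n : ℕ} (G : Subgroup (OrthGroup n)) (k : ℕ) (X : Set (EucSpace n)) : Prop :=
  ∃ π : Fin n → MvPolynomial (Fin n) ℝ, IsBasicInvariants G π ∧
    ∃ (m : ℕ) (f : Fin m → MvPolynomial (Fin n) ℝ),
      (∀ j, f j ∈ Algebra.adjoin ℝ (π '' {i : Fin n | (i : ℕ) < k})) ∧ X = realVariety f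

/-! Write `m = n - 1` and `k = m - 3`. The group contains a reflection subgroup of type `D_m`: there
are orthonormal vectors `e i` such that all reflections in `e i ± e j` lie in `G`, and one further
generator, the reflection in the spin vector `(κ • U - ∑ i, e i) / 2` with `U` orthogonal to all `e
i` (`IsFrame`, obtained in `exists_isFrame`).

Take a point `p` of the variety and move only its coordinates along the `e i`. On this affine slice
every `G`-invariant becomes a polynomial invariant under permutations and even sign changes. If its
degree is at most `2 * k + 1`, it depends only on the power sums of the squares up to exponent `k`
and on the product of the coordinates (`eval_eq_of_evenSign_invariant`). The points of the slice
with the same values of these functions form a compact set, on which the next even power sum attains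
a maximum. There the Lagrange condition makes the squares of the coordinates roots of one nonzero
polynomial of degree at most `k + 1` (a vanishing product needs a variant). Among `k + 3`
coordinates this leaves two coincidences `x i = ± x j`, that is, two independent reflection
hyperplanes through the maximum (`exists_isCodimTwo`, `IsFrame.mem_stratum`).

It remains to see that the first two basic invariants, for any choice of them, have degree at most
`2 * k + 1`, which is 5, 7, 9. If they did not, every invariant of degree at most `2 * k + 1` would
be a function of the first one alone, hence of the norm (`IsBasicInvariants.totalDegree_le`).
Explicit invariants of degree 5, 6, 8 that are not constant on a sphere exclude this; their
invariance is a polynomial identity for the single reflection in the spin vector. -/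

/-! ### Symmetric polynomials and invariants of type `D`. -/

section SymmetricSums

variable {σ : Type*} [Fintype σ] [DecidableEq σ]

/-- The symmetrization `∑_π ∏ i, t (π i) ^ b i` of the monomial with exponent vector `b`. -/
def monomialSum (b : σ → ℕ) (t : σ → ℝ) : ℝ := ∑ π : Equiv.Perm σ, ∏ i, t (π i) ^ b i

theorem monomialSum_comp_perm (b : σ → ℕ) (τ : Equiv.Perm σ) (t : σ → ℝ) :
    monomialSum (b ∘ τ) t = monomialSum b t := by
  unfold monomialSum
  rw [← Equiv.sum_comp (Equiv.mulRight τ)]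
  refine Finset.sum_congr rfl fun π _ => ?_
  exact Equiv.prod_comp τ fun i => t (π i) ^ b i

theorem powerSum_mul_monomialSum (b : σ → ℕ) (c : ℕ) (t : σ → ℝ) :
    (∑ l, t l ^ c) * monomialSum b t = ∑ l, monomialSum (b + Pi.single l c) t := by
  unfold monomialSum
  rw [Finset.sum_comm, Finset.mul_sum]
  refine Finset.sum_congr rfl fun π _ => ?_
  rw [← Equiv.sum_comp π, Finset.sum_mul]
  refine Finset.sum_congr rfl fun l _ => ?_
  simp only [Pi.add_apply, pow_add, Finset.prod_mul_distrib]
  rw [mul_comm, Finset.prod_eq_single_of_mem (f := fun i => t (π i) ^ (Pi.single l c : σ → ℕ) i) l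
    (Finset.mem_univ l) (fun i _ hi => by simp [Pi.single_eq_of_ne hi])]
  simp

/-- Induction on the number of nonzero exponents. Split off one exponent `c` and multiply the rest
by the `c`-th power sum: the terms putting `c` at a free position all equal the wanted sum, and the
others merge `c` into an existing exponent, so they have fewer nonzero exponents and the same total
degree. -/
theorem monomialSum_eq_of_powerSum_eq {k : ℕ} {t t' : σ → ℝ}
    (h : ∀ i, 1 ≤ i → i ≤ k → ∑ l, t l ^ i = ∑ l, t' l ^ i) (b : σ → ℕ) (hb : ∑ i, b i ≤ k) :
    monomialSum b t = monomialSum b t' := by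
  induction hN : (Finset.univ.filter fun i => b i ≠ 0).card using Nat.strong_induction_on
    generalizing b with
  | _ N ih =>
  by_cases hb0 : ∀ i, b i = 0
  · simp [monomialSum, hb0]
  push Not at hb0
  obtain ⟨i₀, hi₀⟩ := hb0
  set c := b i₀ with hc
  set b' := Function.update b i₀ 0 with hb'
  have hbb' : b' + Pi.single i₀ c = b := by
    ext i
    rcases eq_or_ne i i₀ with rfl | hi
    · simp [hb', hc]
    · simp [hb', hi]
  have hsum (l : σ) : ∑ i, (b' + Pi.single l c : σ → ℕ) i = ∑ i, b i := by
    rw [← hbb']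
    simp only [Pi.add_apply, Finset.sum_add_distrib, Finset.sum_pi_single', Finset.mem_univ,
        if_true]
  have hcard : (Finset.univ.filter fun i => b' i ≠ 0).card < N := by
    rw [← hN]
    refine Finset.card_lt_card ⟨fun i hi => ?_, fun hsub => ?_⟩
    · rcases eq_or_ne i i₀ with rfl | hne
      · simp [hb'] at hi
      · simpa [hb', hne] using hi
    · have := hsub (show i₀ ∈ _ by simpa using hi₀)
      simp [hb'] at this
  have hM' : monomialSum b' t = monomialSum b' t' := by
    refine ih _ hcard b' ?_ rfl
    refine le_trans ?_ hb
    rw [← hsum i₀]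
    exact Finset.sum_le_sum fun i _ => by simp
  have key (u : σ → ℝ) : (∑ l, u l ^ c) * monomialSum b' u =
      ((Finset.univ.filter fun l => ¬ b' l ≠ 0).card : ℝ) * monomialSum b u +
      ∑ l ∈ Finset.univ.filter (fun l => b' l ≠ 0), monomialSum (b' + Pi.single l c) u := by
    rw [powerSum_mul_monomialSum, ← Finset.sum_filter_not_add_sum_filter _ (fun l => b' l ≠ 0)]
    congr 1
    rw [← nsmul_eq_mul]
    refine Finset.sum_eq_card_nsmul fun l hl => ?_
    have hl0 : b' l = 0 := by simpa using hl
    have hi0 : b' i₀ = 0 := by simp [hb']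
    conv_rhs => rw [← hbb', ← monomialSum_comp_perm _ (Equiv.swap l i₀)]
    congr 1
    ext i
    rcases eq_or_ne i l with rfl | hil
    · simp [hl0, hi0]
    · rcases eq_or_ne i i₀ with rfl | hii
      · simp [hl0, hi0, hil, hil.symm]
      · simp [Equiv.swap_apply_of_ne_of_ne hil hii, hil, hii]
  -- The position `i₀` just vacated is free, so the wanted sum occurs with a nonzero factor and can
  -- be solved for.
  have hpos : ((Finset.univ.filter fun l => ¬ b' l ≠ 0).card : ℝ) ≠ 0 := by
    rw [Nat.cast_ne_zero]
    refine Finset.card_ne_zero_of_mem (a := i₀) ?_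
    simp [hb']
  have hc1 : 1 ≤ c := Nat.one_le_iff_ne_zero.mpr hi₀
  have hck : c ≤ k := (Finset.single_le_sum (fun i _ => Nat.zero_le (b i))
    (Finset.mem_univ i₀)).trans hb
  have h1 := key t
  rw [h c hc1 hck, hM', key t'] at h1
  have h2 : ∑ l ∈ Finset.univ.filter (fun l => b' l ≠ 0), monomialSum (b' + Pi.single l c) t =
      ∑ l ∈ Finset.univ.filter (fun l => b' l ≠ 0), monomialSum (b' + Pi.single l c) t' := by
    refine Finset.sum_congr rfl fun l hl => ih _ ?_ _ ((hsum l).trans_le hb) rfl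
    refine lt_of_le_of_lt (Finset.card_le_card fun i hi => ?_) hcard
    rcases eq_or_ne i l with rfl | hil
    · exact hl
    · simpa [hil] using hi
  rw [h2] at h1
  exact (mul_left_cancel₀ hpos (add_right_cancel h1)).symm

/-- The point with the signs of its `i`-th and `j`-th coordinates changed. -/
def negPair (i j : σ) (x : σ → ℝ) : σ → ℝ := fun l => if l = i ∨ l = j then -x l else x l

theorem prod_negPair_pow {i j : σ} (hij : i ≠ j) (x : σ → ℝ) (s : σ → ℕ) :
    ∏ l, negPair i j x l ^ s l = (-1) ^ (s i + s j) * ∏ l, x l ^ s l := by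
  have h : ∀ l, negPair i j x l ^ s l =
      ((if l = i then (-1) ^ s i else 1) * (if l = j then (-1) ^ s j else 1)) * x l ^ s l := by
    intro l
    unfold negPair
    rcases eq_or_ne l i with rfl | hi
    · simp [hij, ← mul_pow]
    · rcases eq_or_ne l j with rfl | hj
      · simp [hi, ← mul_pow]
      · simp [hi, hj]
  simp only [h, Finset.prod_mul_distrib, Finset.prod_ite_eq', Finset.mem_univ, if_true, pow_add]

theorem exponents_mod_two_eq {g : MvPolynomial σ ℝ} {i j : σ} (hij : i ≠ j)
    (h : ∀ x, MvPolynomial.eval (negPair i j x) g = MvPolynomial.eval x g)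
    {s : σ →₀ ℕ} (hs : s ∈ g.support) : s i % 2 = s j % 2 := by
  -- The polynomial obtained from `g` by the sign change, written out on coefficients; it agrees
  -- with `g` as a function, hence coefficientwise.
  set g' : MvPolynomial σ ℝ :=
    ∑ s ∈ g.support, MvPolynomial.monomial s ((-1) ^ (s i + s j) * g.coeff s) with hg'
  have hgg' : g' = g := by
    refine MvPolynomial.funext fun x => ?_
    rw [← h x, hg', map_sum, MvPolynomial.eval_eq' (negPair i j x)]
    refine Finset.sum_congr rfl fun s _ => ?_
    rw [prod_negPair_pow hij, MvPolynomial.eval_monomial, Finsupp.prod_fintype _ _ (by simp)]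
    ring
  have hc : (-1) ^ (s i + s j) * g.coeff s = g.coeff s := by
    conv_rhs => rw [← hgg', hg', MvPolynomial.coeff_sum]
    simp only [MvPolynomial.coeff_monomial]
    rw [Finset.sum_ite_eq' g.support s, if_pos hs]
  have h1 : (-1 : ℝ) ^ (s i + s j) = 1 :=
    mul_right_cancel₀ (MvPolynomial.mem_support_iff.mp hs) (by rw [hc, one_mul])
  have h2 : Even (s i + s j) := by
    rwa [neg_one_pow_eq_one_iff_even (by norm_num)] at h1
  rw [Nat.even_iff] at h2
  omega

theorem eval_comp_perm_eq {g : MvPolynomial σ ℝ}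
    (h : ∀ i j, i ≠ j → ∀ x, MvPolynomial.eval (x ∘ Equiv.swap i j) g = MvPolynomial.eval x g)
    (π : Equiv.Perm σ) (x : σ → ℝ) : MvPolynomial.eval (x ∘ π) g = MvPolynomial.eval x g := by
  induction π using Equiv.Perm.swap_induction_on generalizing x with
  | one => rfl
  | swap_mul f i j hij ih =>
    rw [Equiv.Perm.coe_mul, ← Function.comp_assoc, ih, h i j hij]

/-- A polynomial of degree at most `2 * k + 1` that is invariant under permutations and even sign
changes of the coordinates depends only on the first `k` power sums of the squares of the
coordinates and on their product. -/
theorem eval_eq_of_evenSign_invariant [Nonempty σ] {g : MvPolynomial σ ℝ}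
    (hswap : ∀ i j, i ≠ j → ∀ x, MvPolynomial.eval (x ∘ Equiv.swap i j) g = MvPolynomial.eval x g)
    (hneg : ∀ i j, i ≠ j → ∀ x, MvPolynomial.eval (negPair i j x) g = MvPolynomial.eval x g)
    {k : ℕ} (hdeg : g.totalDegree ≤ 2 * k + 1) {x x' : σ → ℝ}
    (hp : ∀ i, 1 ≤ i → i ≤ k → ∑ l, x l ^ (2 * i) = ∑ l, x' l ^ (2 * i))
    (he : ∏ l, x l = ∏ l, x' l) : MvPolynomial.eval x g = MvPolynomial.eval x' g := by
  -- Averaging over all permutations replaces each monomial by its symmetrization.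
  have havg (u : σ → ℝ) : (Fintype.card (Equiv.Perm σ) : ℝ) * MvPolynomial.eval u g =
      ∑ s ∈ g.support, g.coeff s * monomialSum s u := by
    have h1 : ∑ π : Equiv.Perm σ, MvPolynomial.eval (u ∘ π) g =
        (Fintype.card (Equiv.Perm σ) : ℝ) * MvPolynomial.eval u g := by
      simp [eval_comp_perm_eq hswap]
    rw [← h1]
    simp only [MvPolynomial.eval_eq', monomialSum, Finset.mul_sum]
    rw [Finset.sum_comm]
    rfl
  have hcard : (Fintype.card (Equiv.Perm σ) : ℝ) ≠ 0 := by
    exact_mod_cast Fintype.card_ne_zero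
  refine mul_left_cancel₀ hcard ?_
  rw [havg, havg]
  refine Finset.sum_congr rfl fun s hs => ?_
  congr 1
  obtain ⟨i₀⟩ := ‹Nonempty σ›
  set r := s i₀ % 2 with hr
  have hmod (i : σ) : s i = 2 * (s i / 2) + r := by
    have : s i % 2 = r := by
      rcases eq_or_ne i i₀ with rfl | hi
      · rfl
      · exact exponents_mod_two_eq hi (hneg i i₀ hi) hs
    omega
  -- All exponents have the same parity `r`, so the product of the coordinates to the power `r`
  -- splits off and a symmetric function of the squares remains.
  have hM (u : σ → ℝ) : monomialSum s u =
      (∏ l, u l) ^ r * monomialSum (fun i => s i / 2) fun l => u l ^ 2 := by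
    unfold monomialSum
    rw [Finset.mul_sum]
    refine Finset.sum_congr rfl fun π _ => ?_
    rw [← Equiv.prod_comp π u, ← Finset.prod_pow, ← Finset.prod_mul_distrib]
    refine Finset.prod_congr rfl fun i _ => ?_
    conv_lhs => rw [hmod i]
    rw [← pow_mul, pow_add, mul_comm]
  rw [hM, hM, he]
  congr 1
  refine monomialSum_eq_of_powerSum_eq (k := k) (fun i hi hik => ?_) _ ?_
  · simpa only [← pow_mul] using hp i hi hik
  -- Halving absorbs the odd bound: twice the new degree is at most `2 * k + 1`, so the new degree
  -- is at most `k`.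
  · have h1 : ∑ i, s i ≤ 2 * k + 1 := by
      refine le_trans ?_ hdeg
      have := MvPolynomial.le_totalDegree hs
      rwa [Finsupp.sum_fintype _ _ (by simp)] at this
    have h2 : 2 * ∑ i, s i / 2 ≤ ∑ i, s i := by
      rw [Finset.mul_sum]
      exact Finset.sum_le_sum fun i _ => Nat.mul_div_le _ _
    omega

end SymmetricSums

/-! ### Critical points of power sums under constraints. -/

section Critical

variable {σ : Type*}

/-- Pigeonhole twice, with `j` deleted in between. The absence of `j` from the second pair is what
later makes the two roots linearly independent. -/
theorem exists_two_coincidences [DecidableEq σ] {S : Finset σ} {f : σ →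
    ℝ} (h : (S.image f).card + 2 ≤ S.card) :
    ∃ i j i' j', i ≠ j ∧ i' ≠ j' ∧ j ≠ i' ∧ j ≠ j' ∧ f i = f j ∧ f i' = f j' := by
  obtain ⟨i, -, j, hj, hij, hf⟩ := Finset.exists_ne_map_eq_of_card_lt_of_maps_to
    (s := S) (t := S.image f) (f := f) (by omega) (fun x hx => Finset.mem_image_of_mem f hx)
  obtain ⟨i', hi', j', hj', hij', hf'⟩ := Finset.exists_ne_map_eq_of_card_lt_of_maps_to
    (s := S.erase j) (t := S.image f) (f := f) (by rw [Finset.card_erase_of_mem hj]; omega)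
    (fun x hx => Finset.mem_image_of_mem f (Finset.mem_of_mem_erase hx))
  exact ⟨i, j, i', j', hij, hij', (Finset.ne_of_mem_erase hi').symm,
    (Finset.ne_of_mem_erase hj').symm, hf, hf'⟩

/-- `x` is orthogonal to two linearly independent vectors of the form `e_i ± e_j` with `i ≠ j`. -/
def IsCodimTwo (x : σ → ℝ) : Prop :=
  ∃ (i j i' j' : σ) (ε ε' : ℝ), i ≠ j ∧ i' ≠ j' ∧ (ε = 1 ∨ ε = -1) ∧ (ε' = 1 ∨ ε' = -1) ∧
    x i + ε * x j = 0 ∧ x i' + ε' * x j' = 0 ∧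
    (j ≠ i' ∧ j ≠ j' ∨ i = i' ∧ j = j' ∧ ε ≠ ε')

theorem isCodimTwo_of_card_image_sq [DecidableEq σ] {S : Finset σ} {x : σ → ℝ}
    (h : (S.image fun i => x i ^ 2).card + 2 ≤ S.card) : IsCodimTwo x := by
  obtain ⟨i, j, i', j', hij, hij', h1, h2, h3, h4⟩ := exists_two_coincidences h
  have key (a b : ℝ) (hab : a ^ 2 = b ^ 2) : ∃ ε : ℝ, (ε = 1 ∨ ε = -1) ∧ a + ε * b = 0 := by
    rcases sq_eq_sq_iff_eq_or_eq_neg.mp hab with rfl | rfl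
    · exact ⟨-1, .inr rfl, by ring⟩
    · exact ⟨1, .inl rfl, by ring⟩
  obtain ⟨ε, hε, hε0⟩ := key _ _ h3
  obtain ⟨ε', hε', hε0'⟩ := key _ _ h4
  exact ⟨i, j, i', j', ε, ε', hij, hij', hε, hε', hε0, hε0', .inl ⟨h1, h2⟩⟩

theorem isCodimTwo_of_two_zeros {x : σ → ℝ} {a b : σ} (hab : a ≠ b) (ha : x a = 0) (hb : x b = 0) :
    IsCodimTwo x :=
  ⟨a, b, a, b, 1, -1, hab, hab, .inl rfl, .inr rfl, by simp [ha, hb], by simp [ha, hb],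
    .inr ⟨rfl, rfl, by norm_num⟩⟩

theorem card_image_le_of_isRoot {S : Finset σ} {t : σ → ℝ} {P : Polynomial ℝ} (hP : P ≠ 0)
    (h : ∀ i ∈ S, P.eval (t i) = 0) : (S.image t).card ≤ P.natDegree := by
  refine (Finset.card_le_card fun y hy => ?_).trans
    ((Multiset.toFinset_card_le _).trans (P.card_roots'))
  obtain ⟨i, hi, rfl⟩ := Finset.mem_image.mp hy
  simpa [hP] using h i hi

/-- The Lagrange condition for the power sums of the squares and the product forces coincidences
among the squares of the coordinates. -/
theorem isCodimTwo_of_lagrange [Fintype σ] [DecidableEq σ] {k : ℕ} (hσ : Fintype.card σ = k +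
    3) {x : σ → ℝ}
    {Q : Polynomial ℝ} {d : ℝ} (hQ : Q.natDegree ≤ k) (hne : Q ≠ 0 ∨ d ≠ 0)
    (h : ∀ j, x j * Q.eval (x j ^ 2) + d * ∏ l ∈ Finset.univ.erase j, x l = 0) :
    IsCodimTwo x := by
  by_cases he : ∏ l, x l = 0
  · obtain ⟨a, -, ha⟩ := Finset.prod_eq_zero_iff.mp he
    by_cases hb : ∃ b, a ≠ b ∧ x b = 0
    · obtain ⟨b, hab, hb⟩ := hb
      exact isCodimTwo_of_two_zeros hab ha hb
    push Not at hb
    -- With exactly one zero coordinate `a`, the condition at `a` kills `d`; the other `k + 2`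
    -- squares are then roots of `Q` itself.
    have hpa : ∏ l ∈ Finset.univ.erase a, x l ≠ 0 :=
      Finset.prod_ne_zero_iff.mpr fun l hl => hb l (Finset.ne_of_mem_erase hl).symm
    have hd : d = 0 := by
      have := h a
      rw [ha, zero_mul, zero_add] at this
      exact (mul_eq_zero.mp this).resolve_right hpa
    have hQ0 : Q ≠ 0 := hne.resolve_right (not_not.mpr hd)
    refine isCodimTwo_of_card_image_sq (S := Finset.univ.erase a) ?_
    have := card_image_le_of_isRoot (S := Finset.univ.erase a) (t := fun i => x i ^ 2) hQ0
      fun i hi => by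
        have := h i
        rw [hd, zero_mul, add_zero] at this
        exact (mul_eq_zero.mp this).resolve_left (hb i (Finset.ne_of_mem_erase hi).symm)
    rw [Finset.card_erase_of_mem (Finset.mem_univ a), Finset.card_univ]
    omega
  -- Multiplying the `j`-th condition by `x j` completes the partial product, so every `x j ^ 2` is
  -- a root of the same polynomial `P`.
  · set P := Polynomial.X * Q + Polynomial.C (d * ∏ l, x l) with hP
    have hP0 : P ≠ 0 := by
      intro h0
      have h1 : d * ∏ l, x l = 0 := by
        have := congrArg (Polynomial.eval 0) h0
        rwa [hP, Polynomial.eval_add, Polynomial.eval_mul, Polynomial.eval_X, zero_mul, zero_add,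
          Polynomial.eval_C, Polynomial.eval_zero] at this
      have hd : d = 0 := (mul_eq_zero.mp h1).resolve_right he
      rw [hP, h1, map_zero, add_zero] at h0
      rcases hne with hne | hne
      · exact hne ((mul_eq_zero.mp h0).resolve_left Polynomial.X_ne_zero)
      · exact hne hd
    have hdeg : P.natDegree ≤ k + 1 := by
      rw [hP, Polynomial.natDegree_add_C]
      refine Polynomial.natDegree_mul_le.trans ?_
      rw [Polynomial.natDegree_X]
      omega
    refine isCodimTwo_of_card_image_sq (S := Finset.univ) ?_
    have := card_image_le_of_isRoot (S := Finset.univ) (t := fun i => x i ^ 2) hP0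
      fun i _ => by
        have h1 := congrArg (x i * ·) (h i)
        rw [hP, ← Finset.mul_prod_erase Finset.univ x (Finset.mem_univ i)]
        simp only [mul_zero] at h1
        simp only [Polynomial.eval_add, Polynomial.eval_mul, Polynomial.eval_X, Polynomial.eval_C]
        linear_combination h1
    rw [Finset.card_univ]
    omega

theorem hasStrictFDerivAt_sum_pow [Fintype σ] (N : ℕ) (x : σ → ℝ) :
    HasStrictFDerivAt (fun y : σ → ℝ => ∑ l, y l ^ N)
      (∑ l, (N * x l ^ (N - 1)) • (ContinuousLinearMap.proj l : (σ → ℝ) →L[ℝ] ℝ)) x := by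
  refine HasStrictFDerivAt.fun_sum fun l _ => ?_
  simpa using (hasStrictFDerivAt_apply (𝕜 := ℝ) l x).pow N

/-- Every point can be moved, without changing the first `k` power sums of the squares of its
`k + 3` coordinates and their product, to a point orthogonal to two independent roots of `D`. -/
theorem exists_isCodimTwo [Fintype σ] [DecidableEq σ] {k : ℕ} (hk : 1 ≤ k) (hσ : Fintype.card σ =
    k + 3) (x : σ → ℝ) :
    ∃ z : σ → ℝ, (∀ i, 1 ≤ i → i ≤ k → ∑ l, z l ^ (2 * i) = ∑ l, x l ^ (2 * i)) ∧
      ∏ l, z l = ∏ l, x l ∧ IsCodimTwo z := by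
  -- The constraints: `none` is the product, `some i` the power sum of exponent `2 * (i + 1)`.
  set f : Option (Fin k) → (σ → ℝ) → ℝ :=
    fun o y => o.elim (∏ l, y l) fun i => ∑ l, y l ^ (2 * ((i : ℕ) + 1)) with hf
  set φ : (σ → ℝ) → ℝ := fun y => ∑ l, y l ^ (2 * (k + 1)) with hφ
  have hfc : ∀ o, Continuous (f o) := by
    rintro (_ | i)
    · exact continuous_finsetProd _ fun l _ => continuous_apply l
    · exact continuous_finsetSum _ fun l _ => (continuous_apply l).pow _
  have hφc : Continuous φ := continuous_finsetSum _ fun l _ => (continuous_apply l).pow _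
  set K : Set (σ → ℝ) := {y | ∀ o, f o y = f o x} with hK
  have hKclosed : IsClosed K := by
    rw [hK, Set.ofPred_forall]
    exact isClosed_iInter fun o => isClosed_eq (hfc o) continuous_const
  -- The first power sum of squares is among the constraints since `1 ≤ k`, and it bounds every
  -- coordinate.
  have hKbdd : Bornology.IsBounded K := by
    refine (Metric.isBounded_closedBall (x := (0 : σ → ℝ)) (r := 1 + ∑ l, x l ^ 2)).subset ?_
    intro y hy
    have h1 : ∑ l, y l ^ 2 = ∑ l, x l ^ 2 := hy (some ⟨0, hk⟩)
    have h0 : 0 ≤ ∑ l, x l ^ 2 := Finset.sum_nonneg fun l _ => sq_nonneg _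
    rw [mem_closedBall_zero_iff, pi_norm_le_iff_of_nonneg (by linarith)]
    intro i
    have h2 : y i ^ 2 ≤ ∑ l, y l ^ 2 :=
      Finset.single_le_sum (fun l _ => sq_nonneg (y l)) (Finset.mem_univ i)
    rw [Real.norm_eq_abs, abs_le]
    constructor <;> nlinarith
  obtain ⟨z, hzK, hmax⟩ := (Metric.isCompact_of_isClosed_isBounded hKclosed hKbdd).exists_isMaxOn
    ⟨x, fun o => rfl⟩ hφc.continuousOn
  -- The multiplier rule needs the constraint set described by the values at the extremal point `z`
  -- instead of `x`.
  have hKz : K = {y | ∀ o, f o y = f o z} := by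
    ext y
    exact forall_congr' fun o => by rw [hzK o]
  have hextr : IsLocalExtrOn φ {y | ∀ o, f o y = f o z} z := by
    rw [← hKz]
    exact .inr hmax.localize
  set f' : Option (Fin k) → StrongDual ℝ (σ → ℝ) := fun o =>
    o.elim (∑ i, (∏ j ∈ Finset.univ.erase i, z j) • ContinuousLinearMap.proj i)
      fun i => ∑ l, (((2 * ((i : ℕ) + 1) : ℕ) : ℝ) * z l ^ (2 * ((i : ℕ) + 1) - 1)) •
        ContinuousLinearMap.proj l with hf'
  have hfd : ∀ o, HasStrictFDerivAt (f o) (f' o) z := by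
    rintro (_ | i)
    · exact hasStrictFDerivAt_finsetProd
    · exact hasStrictFDerivAt_sum_pow _ z
  obtain ⟨Λ, Λ₀, hΛ, hlag⟩ := hextr.exists_multipliers_of_hasStrictFDerivAt hfd
    (hasStrictFDerivAt_sum_pow _ z)
  refine ⟨z, fun i hi hik => ?_, hzK none, ?_⟩
  · have := hzK (some ⟨i - 1, by omega⟩)
    simpa only [hf, Option.elim, Nat.sub_add_cancel hi] using this
  -- The derivative of each even power sum is `z j` times a power of `z j ^ 2`; `Q` collects these
  -- powers with their multipliers, the maximized function giving the coefficient of degree `k`.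
  set Q : Polynomial ℝ := ∑ i : Fin k,
    Polynomial.monomial (i : ℕ) (Λ (some i) * ((2 * ((i : ℕ) + 1) : ℕ) : ℝ)) +
    Polynomial.monomial k (Λ₀ * ((2 * (k + 1) : ℕ) : ℝ)) with hQ
  have hcoeff_k : Q.coeff k = Λ₀ * ((2 * (k + 1) : ℕ) : ℝ) := by
    rw [hQ, Polynomial.coeff_add, Polynomial.finsetSum_coeff, Polynomial.coeff_monomial, if_pos rfl,
      Finset.sum_eq_zero, zero_add]
    intro i _
    rw [Polynomial.coeff_monomial, if_neg i.2.ne]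
  have hcoeff (i : Fin k) : Q.coeff i = Λ (some i) * ((2 * ((i : ℕ) + 1) : ℕ) : ℝ) := by
    rw [hQ, Polynomial.coeff_add, Polynomial.finsetSum_coeff, Polynomial.coeff_monomial,
      if_neg i.2.ne', add_zero, Finset.sum_eq_single_of_mem i (Finset.mem_univ i)]
    · rw [Polynomial.coeff_monomial, if_pos rfl]
    · intro j _ hj
      rw [Polynomial.coeff_monomial, if_neg fun h => hj (Fin.ext h)]
  refine isCodimTwo_of_lagrange (Q := Q) (d := Λ none) hσ ?_ ?_ fun j => ?_
  · refine (Polynomial.natDegree_add_le_of_degree_le ?_ (Polynomial.natDegree_monomial_le _))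
    exact Polynomial.natDegree_sum_le_of_forall_le _ _ fun i _ =>
      (Polynomial.natDegree_monomial_le _).trans i.2.le
  -- If `Q` and the multiplier of the product both vanished, so would all multipliers.
  · by_contra! hcon
    obtain ⟨hQ0, hd⟩ := hcon
    refine hΛ (Prod.ext (funext ?_) ?_)
    · rintro (_ | i)
      · exact hd
      · have := hcoeff i
        rw [hQ0, Polynomial.coeff_zero, eq_comm, mul_eq_zero] at this
        exact this.resolve_right (by positivity)
    · rw [hQ0, Polynomial.coeff_zero, eq_comm, mul_eq_zero] at hcoeff_k
      exact hcoeff_k.resolve_right (by positivity)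
  · have h1 := congrArg (fun L : StrongDual ℝ (σ → ℝ) => L (Pi.single j 1)) hlag
    simp only [Fintype.sum_option, hf', Option.elim, add_apply,
      smul_apply, sum_apply, ContinuousLinearMap.proj_apply,
      smul_eq_mul, zero_apply, Pi.single_apply, mul_ite, mul_one, mul_zero,
      Finset.sum_ite_eq', Finset.mem_univ, if_true] at h1
    have hpow (i : ℕ) : z j ^ (2 * (i + 1) - 1) = z j * (z j ^ 2) ^ i := by
      rw [← pow_mul, ← pow_succ']
      congr 1
    simp only [hpow] at h1
    rw [hQ, Polynomial.eval_add, Polynomial.eval_finsetSum]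
    simp only [Polynomial.eval_monomial]
    rw [mul_add, Finset.mul_sum, ← h1]
    have : ∀ i : Fin k, z j * (Λ (some i) * ((2 * ((i : ℕ) + 1) : ℕ) : ℝ) * (z j ^ 2) ^ (i : ℕ)) =
        Λ (some i) * (((2 * ((i : ℕ) + 1) : ℕ) : ℝ) * (z j * (z j ^ 2) ^ (i : ℕ))) :=
      fun i => by ring
    rw [Finset.sum_congr rfl fun i _ => this i]
    ring

end Critical

/-! ### Degrees and restriction to lines through the origin. -/

section Degrees

open MvPolynomial

variable {σ τ : Type*} [Fintype σ]

theorem totalDegree_aeval_le_of_affine (f : MvPolynomial σ ℝ) {g : σ → MvPolynomial τ ℝ}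
    (hg : ∀ i, (g i).totalDegree ≤ 1) : (aeval g f).totalDegree ≤ f.totalDegree := by
  rw [aeval_def, eval₂_eq']
  refine totalDegree_finsetSum_le fun s hs => ?_
  refine (totalDegree_mul _ _).trans ?_
  rw [algebraMap_eq, totalDegree_C, zero_add]
  refine (totalDegree_finsetProd _ _).trans ?_
  refine le_trans (Finset.sum_le_sum fun i _ => ?_)
    ((Finsupp.sum_fintype s (fun _ a => a) (fun _ => rfl)).symm.le.trans (le_totalDegree hs))
  exact (totalDegree_pow _ _).trans ((Nat.mul_le_mul_left _ (hg i)).trans (mul_one _).le)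

/-- The restriction of a polynomial to the line spanned by `x`. -/
noncomputable def restrictLine (x : σ → ℝ) : MvPolynomial σ ℝ →ₐ[ℝ] Polynomial ℝ :=
  aeval fun i => Polynomial.C (x i) * Polynomial.X

theorem restrictLine_eval (x : σ → ℝ) (f : MvPolynomial σ ℝ) (r : ℝ) :
    (restrictLine x f).eval r = eval (r • x) f := by
  rw [restrictLine, aeval_def, eval₂_eq', Polynomial.eval_finsetSum, eval_eq']
  refine Finset.sum_congr rfl fun s _ => ?_
  rw [Polynomial.eval_mul, Polynomial.eval_prod]
  congr 1
  · exact Polynomial.eval_C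
  · refine Finset.prod_congr rfl fun i _ => ?_
    rw [Polynomial.eval_pow, Polynomial.eval_mul, Polynomial.eval_C, Polynomial.eval_X, mul_comm]
    rfl

theorem eval_smul_of_isHomogeneous {f : MvPolynomial σ ℝ} {d : ℕ} (hf : f.IsHomogeneous d)
    (x : σ → ℝ) (r : ℝ) : eval (r • x) f = r ^ d * eval x f := by
  rw [eval_eq', eval_eq', Finset.mul_sum]
  refine Finset.sum_congr rfl fun s hs => ?_
  simp only [Pi.smul_apply, smul_eq_mul, mul_pow, Finset.prod_mul_distrib,
    Finset.prod_pow_eq_pow_sum]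
  have : ∑ i, s i = d := by
    rw [hf.degree_eq_sum_deg_support hs]
    exact (Finset.sum_subset (Finset.subset_univ _) fun i _ hi => by simpa using hi).symm
  rw [this]
  ring

theorem restrictLine_of_isHomogeneous {f : MvPolynomial σ ℝ} {d : ℕ} (hf : f.IsHomogeneous d)
    (x : σ → ℝ) : restrictLine x f = Polynomial.C (eval x f) * Polynomial.X ^ d := by
  refine Polynomial.funext fun r => ?_
  rw [restrictLine_eval, eval_smul_of_isHomogeneous hf]
  rw [Polynomial.eval_mul, Polynomial.eval_C, Polynomial.eval_pow, Polynomial.eval_X, mul_comm]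

/-- If all members but one of a family of homogeneous polynomials have degree greater than `D`,
then an element of degree at most `D` of the algebra they generate is a function of that one. -/
theorem eval_eq_of_mem_adjoin_of_degree_le {ι : Type*} {D : ℕ} {π : ι → MvPolynomial σ ℝ} (i₀ : ι)
    (hom : ∀ i, (π i).IsHomogeneous (π i).totalDegree)
    (hbig : ∀ i, i ≠ i₀ → D < (π i).totalDegree) {f : MvPolynomial σ ℝ}
    (hf : f ∈ Algebra.adjoin ℝ (Set.range π)) (hfD : f.totalDegree ≤ D) {x x' : σ → ℝ}
    (h : eval x (π i₀) = eval x' (π i₀)) : eval x f = eval x' f := by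
  -- On a line each generator becomes its value times a power of the parameter. Modulo degree `D +
  -- 1` all generators but `π i₀` vanish, and this is respected by sums and products; hence the
  -- bound on the degree of `f` is set aside during the induction.
  have key : ∀ j ≤ D, (restrictLine x f).coeff j = (restrictLine x' f).coeff j := by
    clear hfD
    induction hf using Algebra.adjoin_induction with
    | mem a ha =>
      obtain ⟨i, rfl⟩ := ha
      intro j hj
      rw [restrictLine_of_isHomogeneous (hom i), restrictLine_of_isHomogeneous (hom i)]
      by_cases hi : i = i₀
      · rw [hi, h]
      · have := hbig i hi
        rw [Polynomial.coeff_C_mul_X_pow, Polynomial.coeff_C_mul_X_pow, if_neg (by omega),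
          if_neg (by omega)]
    | algebraMap r => simp
    | add a b _ _ ha hb =>
      intro j hj
      rw [map_add, map_add, Polynomial.coeff_add, Polynomial.coeff_add, ha j hj, hb j hj]
    | mul a b _ _ ha hb =>
      intro j hj
      rw [map_mul, map_mul, Polynomial.coeff_mul, Polynomial.coeff_mul]
      refine Finset.sum_congr rfl fun p hp => ?_
      rw [Finset.HasAntidiagonal.mem_antidiagonal] at hp
      rw [ha p.1 (by omega), hb p.2 (by omega)]
  have hdeg (u : σ → ℝ) : (restrictLine u f).natDegree ≤ D := by
    simpa [restrictLine] using aeval_natDegree_le f hfD (n :=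
        1) (fun i => Polynomial.C (u i) * Polynomial.X)
      fun i => (Polynomial.natDegree_C_mul_le _ _).trans Polynomial.natDegree_X_le
  have heq : restrictLine x f = restrictLine x' f := by
    ext j
    rcases le_or_gt j D with hj | hj
    · exact key j hj
    · rw [Polynomial.coeff_eq_zero_of_natDegree_lt ((hdeg x).trans_lt hj),
        Polynomial.coeff_eq_zero_of_natDegree_lt ((hdeg x').trans_lt hj)]
  have := congrArg (Polynomial.eval 1) heq
  rwa [restrictLine_eval, restrictLine_eval, one_smul, one_smul] at this

end Degrees

/-! ### Bounding the degree of the second basic invariant. -/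

section SecondDegree

variable {n : ℕ}

theorem continuous_evalAt (f : MvPolynomial (Fin n) ℝ) :
    Continuous fun p : EucSpace n => evalAt p f :=
  (MvPolynomial.continuous_eval f).comp (PiLp.continuous_ofLp 2 _)

theorem evalAt_smul {f : MvPolynomial (Fin n) ℝ} {d : ℕ} (hf : f.IsHomogeneous d)
    (p : EucSpace n) (r : ℝ) : evalAt (r • p) f = r ^ d * evalAt p f :=
  eval_smul_of_isHomogeneous hf p.ofLp r

/-- The squared norm as a polynomial. -/
noncomputable def normSqPoly (n : ℕ) : MvPolynomial (Fin n) ℝ := ∑ i, MvPolynomial.X i ^ 2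

theorem evalAt_normSqPoly (p : EucSpace n) : evalAt p (normSqPoly n) = ‖p‖ ^ 2 := by
  simp [evalAt, normSqPoly, EuclideanSpace.norm_sq_eq]

theorem normSqPoly_mem_invariantRing (G : Subgroup (OrthGroup n)) :
    normSqPoly n ∈ invariantRing G := by
  intro g _ p
  rw [evalAt_normSqPoly, evalAt_normSqPoly, LinearIsometryEquiv.norm_map]

theorem totalDegree_normSqPoly_le : (normSqPoly n).totalDegree ≤ 2 :=
  (MvPolynomial.IsHomogeneous.sum _ _ _ fun i _ =>
    MvPolynomial.isHomogeneous_X_pow (R := ℝ) i 2).totalDegree_le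

/-- A function of a homogeneous polynomial `f` which determines the norm is constant on spheres. -/
theorem evalAt_eq_of_norm_eq (hn : 2 ≤ n) {f : MvPolynomial (Fin n) ℝ} {d : ℕ}
    (hf : f.IsHomogeneous d)
    (hnorm : ∀ p q : EucSpace n, evalAt p f = evalAt q f → ‖p‖ = ‖q‖) {p q : EucSpace n}
    (hpq : ‖p‖ = ‖q‖) : evalAt p f = evalAt q f := by
  rcases eq_or_ne p 0 with rfl | hp
  · rw [norm_zero, eq_comm, norm_eq_zero] at hpq
    rw [hpq]
  have hq : q ≠ 0 := by
    rintro rfl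
    rw [norm_zero, norm_eq_zero] at hpq
    exact hp hpq
  have hd : d ≠ 0 := by
    rintro rfl
    have h1 := evalAt_smul hf p 0
    rw [zero_smul, pow_zero, one_mul] at h1
    have := hnorm _ _ h1
    rw [norm_zero, eq_comm, norm_eq_zero] at this
    exact hp this
  have h0 : evalAt (0 : EucSpace n) f = 0 := by
    have h1 := evalAt_smul hf (0 : EucSpace n) 0
    rwa [smul_zero, zero_pow hd, zero_mul] at h1
  have hne : ∀ y : EucSpace n, y ≠ 0 → evalAt y f ≠ 0 := by
    intro y hy hy0
    have := hnorm y 0 (hy0.trans h0.symm)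
    rw [norm_zero, norm_eq_zero] at this
    exact hy this
  have hconn : IsPreconnected ({0}ᶜ : Set (EucSpace n)) := by
    refine (isConnected_compl_singleton_of_one_lt_rank ?_ 0).isPreconnected
    rw [← Module.finrank_eq_rank, finrank_euclideanSpace_fin]
    exact_mod_cast hn
  -- `f` vanishes only at the origin, whose complement is connected in dimension at least two, so
  -- `f` has constant sign there.
  have hpos : 0 < evalAt p f / evalAt q f := by
    have hq0 := hne q hq
    refine lt_of_le_of_ne' ?_ (div_ne_zero (hne p hp) hq0)
    by_contra! hlt
    have himg := hconn.image _ (continuous_evalAt f).continuousOn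
    have hmem : (0 : ℝ) ∈ (fun y : EucSpace n => evalAt y f) '' {0}ᶜ := by
      rcases div_neg_iff.mp hlt with ⟨h1, h2⟩ | ⟨h1, h2⟩
      · exact himg.ordConnected.out ⟨q, hq, rfl⟩ ⟨p, hp, rfl⟩ ⟨h2.le, h1.le⟩
      · exact himg.ordConnected.out ⟨p, hp, rfl⟩ ⟨q, hq, rfl⟩ ⟨h1.le, h2.le⟩
    obtain ⟨y, hy, hy0⟩ := hmem
    exact hne y hy hy0
  -- The factor for which `r • q` has the same value of `f` as `p`; equality of norms then forces `r
  -- = 1`.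
  set r := (evalAt p f / evalAt q f) ^ ((d : ℝ)⁻¹) with hr
  have hr0 : 0 < r := Real.rpow_pos_of_pos hpos _
  have hrd : r ^ d = evalAt p f / evalAt q f := Real.rpow_inv_natCast_pow hpos.le hd
  have h1 : evalAt (r • q) f = evalAt p f := by
    rw [evalAt_smul hf, hrd, div_mul_cancel₀ _ (hne q hq)]
  have h2 := hnorm _ _ h1
  rw [norm_smul, Real.norm_of_nonneg hr0.le, hpq] at h2
  have hr1 : r = 1 := mul_right_cancel₀ (norm_ne_zero_iff.mpr hq) (h2.trans (one_mul _).symm)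
  rw [← h1, hr1, one_smul]

/-- An invariant of degree at most `D` that is not constant on spheres bounds the degree of the
second basic invariant. -/
theorem IsBasicInvariants.totalDegree_le {G : Subgroup (OrthGroup n)}
    {π : Fin n → MvPolynomial (Fin n) ℝ} (hn : 2 ≤ n) (hπ : IsBasicInvariants G π) {D : ℕ}
    (hD : 2 ≤ D)
    {F : MvPolynomial (Fin n) ℝ} (hF : F ∈ invariantRing G) (hFD : F.totalDegree ≤ D)
    {p q : EucSpace n} (hpq : ‖p‖ = ‖q‖) (hne : evalAt p F ≠ evalAt q F)
    {i : Fin n} (hi : (i : ℕ) < 2) : (π i).totalDegree ≤ D := by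
  by_contra! hcon
  set i₀ : Fin n := ⟨0, by omega⟩
  have hbig : ∀ j, j ≠ i₀ → D < (π j).totalDegree := by
    intro j hj
    have hj0 : (j : ℕ) ≠ 0 := fun h => hj (Fin.ext h)
    exact hcon.trans_le (hπ.monotone_degree (Fin.le_def.mpr (by omega)))
  have hfun : ∀ f ∈ invariantRing G, f.totalDegree ≤ D → ∀ u v : EucSpace n,
      evalAt u (π i₀) = evalAt v (π i₀) → evalAt u f = evalAt v f := fun f hf hfD u v huv =>
    eval_eq_of_mem_adjoin_of_degree_le i₀ hπ.homogeneous hbig (hπ.adjoin_eq ▸ hf) hfD huv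
  -- The squared norm is itself an invariant of degree at most `D`, hence a function of `π i₀`. So
  -- `π i₀` determines the norm and is constant on spheres, and then so is `F`.
  refine hne (hfun F hF hFD p q (evalAt_eq_of_norm_eq hn (hπ.homogeneous i₀) ?_ hpq))
  intro u v huv
  have := hfun _ (normSqPoly_mem_invariantRing G) (totalDegree_normSqPoly_le.trans hD) u v huv
  rw [evalAt_normSqPoly, evalAt_normSqPoly] at this
  exact (sq_eq_sq₀ (norm_nonneg _) (norm_nonneg _)).mp this

end SecondDegree

/-! ### Reflections and the subgroup of type `D` in a frame. -/

section Reflections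

variable {n : ℕ}

theorem reflectionAlong_apply (v p : EucSpace n) :
    reflectionAlong v p = p - (2 * ⟪v, p⟫ / ⟪v, v⟫) • v := by
  rw [reflectionAlong, Submodule.reflection_orthogonal_apply, Submodule.reflection_singleton_apply,
    real_inner_self_eq_norm_sq, neg_sub, ← Nat.cast_smul_eq_nsmul ℝ, smul_smul]
  simp [mul_div_assoc]

theorem reflectionAlong_smul {c : ℝ} (hc : c ≠ 0) (v : EucSpace n) :
    reflectionAlong (c • v) = reflectionAlong v := by
  ext1 p
  simp only [reflectionAlong_apply, inner_smul_left, inner_smul_right, smul_smul]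
  congr 2
  simp only [conj_trivial]
  field_simp

theorem reflectionAlong_map (g : OrthGroup n) (v : EucSpace n) :
    reflectionAlong (g v) = g * reflectionAlong v * g⁻¹ := by
  ext1 p
  change _ = g (reflectionAlong v (g.symm p))
  obtain ⟨q, rfl⟩ := g.surjective p
  simp [reflectionAlong_apply, LinearIsometryEquiv.inner_map_map]

/-- Reflecting one root of `G` in another one gives a root of `G`. -/
theorem reflectionAlong_mem_of_eq {G : Subgroup (OrthGroup n)} {u v w : EucSpace n}
    (hu : reflectionAlong u ∈ G) (hv : reflectionAlong v ∈ G)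
    (hw : w = v - (2 * ⟪u, v⟫ / ⟪u, u⟫) • u) : reflectionAlong w ∈ G := by
  rw [hw, ← reflectionAlong_apply, reflectionAlong_map]
  exact G.mul_mem (G.mul_mem hu hv) (G.inv_mem hu)

/-- Orthonormal vectors `e i` and a vector `U` orthogonal to them such that `G` is generated by
reflections in the vectors `e i ± e j` and `(κ • U - ∑ i, e i) / 2` (of squared length `2`),
and contains the reflections in a system of simple roots. -/
structure IsFrame {m : ℕ} (G : Subgroup (OrthGroup n)) (κ : ℝ) (e : Fin m → EucSpace n)
    (U : EucSpace n) : Prop where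
  pos : 0 < κ
  kappa_add : κ + m = 8
  inner_e : ∀ i j, ⟪e i, e j⟫ = if i = j then 1 else 0
  inner_eU : ∀ i, ⟪e i, U⟫ = 0
  inner_U : ⟪U, U⟫ = 1 / κ
  sub_mem : ∀ i j : Fin m, (j : ℕ) = i + 1 → reflectionAlong (e j - e i) ∈ G
  add_mem : ∀ i j : Fin m, (i : ℕ) = 0 → (j : ℕ) = 1 → reflectionAlong (e i + e j) ∈ G
  generated : ∃ S : Set (EucSpace n), G = Subgroup.closure (reflectionAlong '' S) ∧
    ∀ v ∈ S, (∃ i j, i ≠ j ∧ (v = e j - e i ∨ v = e i + e j)) ∨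
      v = (1 / 2 : ℝ) • (κ • U - ∑ i, e i)

namespace IsFrame

variable {m : ℕ} {G : Subgroup (OrthGroup n)} {κ : ℝ} {e : Fin m → EucSpace n} {U : EucSpace n}

theorem reflectionAlong_sub_mem (h : IsFrame G κ e U) {i j : Fin m} (hij : i ≠ j) :
    reflectionAlong (e i - e j) ∈ G := by
  -- Reflecting `e j - e l` in `e l - e i` gives `e j - e i`, so neighbouring differences generate
  -- all of them.
  have key : ∀ d : ℕ, ∀ i j : Fin m, (j : ℕ) = i + d + 1 → reflectionAlong (e j - e i) ∈ G := by
    intro d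
    induction d with
    | zero => exact fun i j hij => h.sub_mem i j hij
    | succ d ih =>
      intro i j hij
      set l : Fin m := ⟨i + d + 1, by omega⟩ with hl
      have h1 := ih i l rfl
      have h2 := h.sub_mem l j (by simp [hl, hij]; omega)
      have hil : i ≠ l := Fin.ne_of_val_ne (by simp [hl]; omega)
      have hjl : j ≠ l := Fin.ne_of_val_ne (by simp [hl]; omega)
      have hij' : i ≠ j := Fin.ne_of_val_ne (by omega)
      refine reflectionAlong_mem_of_eq h1 h2 ?_
      simp only [inner_sub_left, inner_sub_right, h.inner_e, hil, hij', hil.symm, hjl.symm,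
        if_true, if_false]
      norm_num
  rcases lt_or_gt_of_ne hij with hlt | hlt
  · have := key (j - i - 1) i j (by have := Fin.lt_def.mp hlt; omega)
    rw [← neg_sub, ← neg_one_smul ℝ, reflectionAlong_smul (by norm_num)]
    exact this
  · exact key (i - j - 1) j i (by have := Fin.lt_def.mp hlt; omega)

theorem reflectionAlong_add_mem (h : IsFrame G κ e U) (hm : 2 ≤ m) {i j : Fin m} (hij : i ≠ j) :
    reflectionAlong (e i + e j) ∈ G := by
  have step : ∀ {a b c : Fin m}, a ≠ b → a ≠ c → b ≠ c → reflectionAlong (e a + e b) ∈ G →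
      reflectionAlong (e c + e b) ∈ G := by
    intro a b c hab hac hbc h1
    refine reflectionAlong_mem_of_eq (h.reflectionAlong_sub_mem hac) h1 ?_
    simp only [inner_sub_left, inner_sub_right, inner_add_right, h.inner_e, hab, hac,
      hac.symm, hbc.symm, if_true, if_false]
    norm_num
    abel
  set z : Fin m := ⟨0, by omega⟩
  set o : Fin m := ⟨1, by omega⟩
  have hzo : z ≠ o := Fin.ne_of_val_ne (by simp [z, o])
  have key : ∀ j, z ≠ j → reflectionAlong (e z + e j) ∈ G := by
    intro j hj
    have h01 := h.add_mem z o rfl rfl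
    rcases eq_or_ne o j with rfl | hoj
    · exact h01
    · rw [add_comm] at h01 ⊢
      exact step hzo.symm hoj hj h01
  rcases eq_or_ne z i with rfl | hi
  · exact key j hij
  rcases eq_or_ne z j with rfl | hj
  · rw [add_comm]
    exact key i hi
  · exact step hj hi hij.symm (key j hj)

/-- The coordinates of a point with respect to the orthonormal vectors of a frame. -/
noncomputable def coords (e : Fin m → EucSpace n) (p : EucSpace n) : Fin m → ℝ := fun i => ⟪e i, p⟫

theorem coords_reflectionAlong_sub (h : IsFrame G κ e U) {i j : Fin m} (hij : i ≠ j)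
    (p : EucSpace n) :
    coords e (reflectionAlong (e i - e j) p) = coords e p ∘ Equiv.swap i j := by
  ext l
  simp only [coords, reflectionAlong_apply, inner_sub_left, inner_sub_right, inner_smul_right,
    h.inner_e, hij, hij.symm, if_true, if_false, Function.comp_apply]
  rcases eq_or_ne l i with rfl | hi
  · simp [hij]; ring
  rcases eq_or_ne l j with rfl | hj
  · simp [hij.symm]; ring
  · simp [hi, hj, Equiv.swap_apply_of_ne_of_ne hi hj]

theorem coords_reflectionAlong_add (h : IsFrame G κ e U) {i j : Fin m} (hij : i ≠ j)
    (p : EucSpace n) :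
    coords e (reflectionAlong (e i + e j) p) = negPair i j (coords e p ∘ Equiv.swap i j) := by
  ext l
  simp only [coords, reflectionAlong_apply, inner_add_left, inner_add_right, inner_sub_right,
    inner_smul_right, h.inner_e, hij, hij.symm, if_true, if_false, negPair, Function.comp_apply]
  rcases eq_or_ne l i with rfl | hi
  · simp [hij]; ring
  rcases eq_or_ne l j with rfl | hj
  · simp [hij.symm]; ring
  · simp [hi, hj, Equiv.swap_apply_of_ne_of_ne hi hj]

theorem inner_U_e (h : IsFrame G κ e U) (i : Fin m) : ⟪U, e i⟫ = 0 := by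
  rw [real_inner_comm, h.inner_eU]

theorem inner_U_reflectionAlong_sub (h : IsFrame G κ e U) (i j : Fin m) (p : EucSpace n) :
    ⟪U, reflectionAlong (e i - e j) p⟫ = ⟪U, p⟫ := by
  simp [reflectionAlong_apply, inner_sub_right, inner_smul_right, h.inner_U_e]

theorem inner_U_reflectionAlong_add (h : IsFrame G κ e U) (i j : Fin m) (p : EucSpace n) :
    ⟪U, reflectionAlong (e i + e j) p⟫ = ⟪U, p⟫ := by
  simp [reflectionAlong_apply, inner_add_right, inner_sub_right, inner_smul_right, h.inner_U_e]

theorem inner_e_spin (h : IsFrame G κ e U) (i : Fin m) :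
    ⟪e i, (1 / 2 : ℝ) • (κ • U - ∑ i, e i)⟫ = -1 / 2 := by
  simp only [inner_smul_right, inner_sub_right, inner_sum, h.inner_e, h.inner_eU, Finset.sum_ite_eq,
    Finset.mem_univ, if_true]
  ring

theorem inner_U_spin (h : IsFrame G κ e U) :
    ⟪U, (1 / 2 : ℝ) • (κ • U - ∑ i, e i)⟫ = 1 / 2 := by
  simp only [inner_smul_right, inner_sub_right, inner_sum, h.inner_U_e, h.inner_U]
  have := h.pos.ne'
  simp [this]

theorem inner_spin (κ : ℝ) (e : Fin m → EucSpace n) (U p : EucSpace n) :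
    ⟪(1 / 2 : ℝ) • (κ • U - ∑ i, e i), p⟫ = (κ * ⟪U, p⟫ - ∑ i, coords e p i) / 2 := by
  simp only [inner_smul_left, inner_sub_left, sum_inner, coords]
  simp
  ring

/-- The squared length is `(κ + m) / 4`, which explains the normalization `κ + m = 8`. -/
theorem inner_spin_self (h : IsFrame G κ e U) :
    ⟪(1 / 2 : ℝ) • (κ • U - ∑ i, e i), (1 / 2 : ℝ) • (κ • U - ∑ i, e i)⟫ = 2 := by
  rw [inner_spin, h.inner_U_spin]
  simp only [coords, h.inner_e_spin]
  have := h.kappa_add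
  simp
  linarith

theorem reflectionAlong_spin (h : IsFrame G κ e U) (p : EucSpace n) :
    reflectionAlong ((1 / 2 : ℝ) • (κ • U - ∑ i, e i)) p =
      p - ((κ * ⟪U, p⟫ - ∑ i, coords e p i) / 2) • ((1 / 2 : ℝ) • (κ • U - ∑ i, e i)) := by
  rw [reflectionAlong_apply, h.inner_spin_self, inner_spin]
  congr 2
  ring

/-- A polynomial given by a formula in the even power sums and the product of the coordinates
`⟪e i, p⟫` and in `⟪U, p⟫` is invariant if the formula is preserved by the remaining reflection. -/
theorem mem_invariantRing (h : IsFrame G κ e U) {F : MvPolynomial (Fin n) ℝ}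
    {Φ : (ℕ → ℝ) → ℝ → ℝ → ℝ}
    (hF : ∀ p, evalAt p F =
      Φ (fun k => ∑ i, coords e p i ^ (2 * k)) (∏ i, coords e p i) ⟪U, p⟫)
    (hspin : ∀ (w : Fin m → ℝ) (Y τ : ℝ), κ * Y = ∑ i, w i + 4 * τ →
      Φ (fun k => ∑ i, (w i + τ) ^ (2 * k)) (∏ i, (w i + τ)) (Y - τ) =
        Φ (fun k => ∑ i, w i ^ (2 * k)) (∏ i, w i) Y) :
    F ∈ invariantRing G := by
  have hsw (i j : Fin m) (w : Fin m → ℝ) (k : ℕ) :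
      ∑ l, (w ∘ Equiv.swap i j) l ^ k = ∑ l, w l ^ k :=
    Equiv.sum_comp (Equiv.swap i j) fun l => w l ^ k
  have hsw' (i j : Fin m) (w : Fin m → ℝ) : ∏ l, (w ∘ Equiv.swap i j) l = ∏ l, w l :=
    Equiv.prod_comp (Equiv.swap i j) w
  have hng (i j : Fin m) (w : Fin m → ℝ) (k : ℕ) :
      ∑ l, negPair i j w l ^ (2 * k) = ∑ l, w l ^ (2 * k) := by
    refine Finset.sum_congr rfl fun l _ => ?_
    unfold negPair
    split_ifs
    · rw [(even_two_mul k).neg_pow]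
    · rfl
  have hng' {i j : Fin m} (hij : i ≠ j) (w : Fin m → ℝ) : ∏ l, negPair i j w l = ∏ l, w l := by
    have := prod_negPair_pow hij w fun _ => 1
    simpa using this
  have hsub {i j : Fin m} (hij : i ≠ j) (p : EucSpace n) :
      evalAt (reflectionAlong (e i - e j) p) F = evalAt p F := by
    rw [hF, hF, h.inner_U_reflectionAlong_sub, h.coords_reflectionAlong_sub hij]
    simp only [hsw, hsw']
  have hadd {i j : Fin m} (hij : i ≠ j) (p : EucSpace n) :
      evalAt (reflectionAlong (e i + e j) p) F = evalAt p F := by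
    rw [hF, hF, h.inner_U_reflectionAlong_add, h.coords_reflectionAlong_add hij]
    simp only [hng, hng' hij, hsw, hsw']
  have hsp (p : EucSpace n) :
      evalAt (reflectionAlong ((1 / 2 : ℝ) • (κ • U - ∑ i, e i)) p) F = evalAt p F := by
    -- Half the inner product of `p` with the spin vector: the reflection adds `τ` to every
    -- coordinate and subtracts it from the `U`-component.
    set τ := (κ * ⟪U, p⟫ - ∑ i, coords e p i) / 4 with hτ
    have h1 : ∀ i, coords e (reflectionAlong ((1 / 2 : ℝ) • (κ • U - ∑ i, e i)) p) i =
        coords e p i + τ := by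
      intro i
      rw [h.reflectionAlong_spin, coords, inner_sub_right, inner_smul_right, h.inner_e_spin, hτ]
      simp only [coords]
      ring
    have h2 : ⟪U, reflectionAlong ((1 / 2 : ℝ) • (κ • U - ∑ i, e i)) p⟫ = ⟪U, p⟫ - τ := by
      rw [h.reflectionAlong_spin, inner_sub_right, inner_smul_right, h.inner_U_spin, hτ]
      ring
    rw [hF, hF, h2]
    simp only [h1]
    exact hspin _ _ _ (by rw [hτ]; ring)
  obtain ⟨S, hS, hSv⟩ := h.generated
  intro g hg
  rw [hS] at hg
  induction hg using Subgroup.closure_induction with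
  | mem g hg =>
    obtain ⟨v, hv, rfl⟩ := hg
    rcases hSv v hv with ⟨i, j, hij, rfl | rfl⟩ | rfl
    · exact hsub hij.symm
    · exact hadd hij
    · exact hsp
  | one => exact fun p => rfl
  | mul a b _ _ ha hb => exact fun p => (ha (b p)).trans (hb p)
  | inv a _ ha =>
    intro p
    have := ha (a⁻¹ p)
    rw [← this]
    congr 1
    exact (a.apply_symm_apply p)

end IsFrame

end Reflections

/-! ### Explicit invariants of degree 5, 6 and 8. -/

section Invariants

variable {n m : ℕ}

/-- The linear form `p ↦ ⟪v, p⟫` as a polynomial. -/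
noncomputable def linearForm (v : EucSpace n) : MvPolynomial (Fin n) ℝ :=
  ∑ j, MvPolynomial.C (v j) * MvPolynomial.X j

theorem evalAt_linearForm (v p : EucSpace n) : evalAt p (linearForm v) = ⟪v, p⟫ := by
  simp [evalAt, linearForm, PiLp.inner_apply, mul_comm]

theorem isHomogeneous_linearForm (v : EucSpace n) : (linearForm v).IsHomogeneous 1 :=
  MvPolynomial.IsHomogeneous.sum _ _ _ fun i _ => MvPolynomial.isHomogeneous_C_mul_X _ i

/-- The sum of the `2 * k`-th powers of the linear forms given by the `e i`. -/
noncomputable def evenPowerSum (e : Fin m → EucSpace n) (k : ℕ) : MvPolynomial (Fin n) ℝ :=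
  ∑ i, linearForm (e i) ^ (2 * k)

theorem isHomogeneous_evenPowerSum (e : Fin m → EucSpace n) (k : ℕ) :
    (evenPowerSum e k).IsHomogeneous (2 * k) :=
  MvPolynomial.IsHomogeneous.sum _ _ _ fun i _ => by
    simpa using (isHomogeneous_linearForm (e i)).pow (2 * k)

theorem evalAt_evenPowerSum (e : Fin m → EucSpace n) (k : ℕ) (p : EucSpace n) :
    evalAt p (evenPowerSum e k) = ∑ i, IsFrame.coords e p i ^ (2 * k) := by
  simp only [evenPowerSum, IsFrame.coords, ← evalAt_linearForm]
  simp [evalAt]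

/-- The product of the linear forms given by the `e i`. -/
noncomputable def prodForm (e : Fin m → EucSpace n) : MvPolynomial (Fin n) ℝ :=
  ∏ i, linearForm (e i)

theorem isHomogeneous_prodForm (e : Fin m → EucSpace n) : (prodForm e).IsHomogeneous m := by
  simpa [prodForm] using MvPolynomial.IsHomogeneous.prod Finset.univ (fun i => linearForm (e i))
      (fun _ => 1)
    fun i _ => isHomogeneous_linearForm (e i)

theorem evalAt_prodForm (e : Fin m → EucSpace n) (p : EucSpace n) :
    evalAt p (prodForm e) = ∏ i, IsFrame.coords e p i := by
  simp only [prodForm, IsFrame.coords, ← evalAt_linearForm]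
  simp [evalAt]

/-- A formula for an invariant of degree 5 of the group of type `E₆`, in terms of even power sums,
the product of the coordinates, and the last coordinate. -/
def formulaE₆ (s : ℕ → ℝ) (q y : ℝ) : ℝ :=
  3 * (y ^ 5) + (-2) * (y ^ 3 * s 1) + 1 * (y * s 1 * s 1) + (-2) * (y * s 2) + 8 * (q)

/-- Both sides are symmetric in `w`. Newton's identities express them through the elementary
symmetric functions and `τ`, with `y` eliminated by the hypothesis; the rest is an identity in these
few variables. -/
theorem formulaE₆_spin (w : Fin 5 → ℝ) (y τ : ℝ) (hy : (3 : ℝ) * y = ∑ i, w i + 4 * τ) :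
    formulaE₆ (fun k => ∑ i, (w i + τ) ^ (2 * k)) (∏ i, (w i + τ)) (y - τ) =
      formulaE₆ (fun k => ∑ i, w i ^ (2 * k)) (∏ i, w i) y := by
  simp only [formulaE₆]
  simp only [Fin.sum_univ_five, Fin.prod_univ_five] at hy ⊢
  generalize w 0 = a at *
  generalize w 1 = b at *
  generalize w 2 = c at *
  generalize w 3 = d at *
  generalize w 4 = f at *
  -- Introduced as opaque variables, so that the final `ring` never expands in the coordinates.
  obtain ⟨e₁, he₁⟩ : ∃ r, r = a + b + c + d + f := ⟨_, rfl⟩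
  obtain ⟨e₂, he₂⟩ : ∃ r, r = a * b + a * c + a * d + a * f + b * c + b * d + b * f + c * d +
      c * f + d * f := ⟨_, rfl⟩
  obtain ⟨e₃, he₃⟩ : ∃ r, r = a * b * c + a * b * d + a * b * f + a * c * d + a * c * f +
      a * d * f + b * c * d + b * c * f + b * d * f + c * d * f := ⟨_, rfl⟩
  obtain ⟨e₄, he₄⟩ : ∃ r, r = a * b * c * d + a * b * c * f + a * b * d * f + a * c * d * f +
      b * c * d * f := ⟨_, rfl⟩
  obtain ⟨e₅, he₅⟩ : ∃ r, r = a * b * c * d * f := ⟨_, rfl⟩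
  obtain ⟨p₁, hp₁⟩ : ∃ r, r = a ^ 1 + b ^ 1 + c ^ 1 + d ^ 1 + f ^ 1 := ⟨_, rfl⟩
  obtain ⟨p₂, hp₂⟩ : ∃ r, r = a ^ 2 + b ^ 2 + c ^ 2 + d ^ 2 + f ^ 2 := ⟨_, rfl⟩
  obtain ⟨p₃, hp₃⟩ : ∃ r, r = a ^ 3 + b ^ 3 + c ^ 3 + d ^ 3 + f ^ 3 := ⟨_, rfl⟩
  obtain ⟨p₄, hp₄⟩ : ∃ r, r = a ^ 4 + b ^ 4 + c ^ 4 + d ^ 4 + f ^ 4 := ⟨_, rfl⟩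
  have n₁ : p₁ = 1 * e₁ := by
    rw [hp₁, he₁]; ring
  have n₂ : p₂ = e₁ * p₁ - 2 * e₂ := by
    rw [hp₁, hp₂, he₁, he₂]; ring
  have n₃ : p₃ = e₁ * p₂ - e₂ * p₁ + 3 * e₃ := by
    rw [hp₁, hp₂, hp₃, he₁, he₂, he₃]; ring
  have n₄ : p₄ = e₁ * p₃ - e₂ * p₂ + e₃ * p₁ - 4 * e₄ := by
    rw [hp₁, hp₂, hp₃, hp₄, he₁, he₂, he₃, he₄]; ring
  have s₁ : (a + τ) ^ 2 + (b + τ) ^ 2 + (c + τ) ^ 2 + (d + τ) ^ 2 + (f + τ) ^ 2 = p₂ +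
      2 * τ ^ 1 * p₁ + 1 * τ ^ 2 * 5 := by
    rw [hp₁, hp₂]; ring
  have s₂ : (a + τ) ^ 4 + (b + τ) ^ 4 + (c + τ) ^ 4 + (d + τ) ^ 4 + (f + τ) ^ 4 = p₄ +
      4 * τ ^ 1 * p₃ + 6 * τ ^ 2 * p₂ + 4 * τ ^ 3 * p₁ + 1 * τ ^ 4 * 5 := by
    rw [hp₁, hp₂, hp₃, hp₄]; ring
  have q : (a + τ) * (b + τ) * (c + τ) * (d + τ) * (f + τ) = e₅ + τ ^ 1 * e₄ + τ ^ 2 * e₃ +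
      τ ^ 3 * e₂ + τ ^ 4 * e₁ + τ ^ 5 := by
    rw [he₁, he₂, he₃, he₄, he₅]; ring
  have hy₁ : y = (e₁ + 4 * τ) / 3 := by rw [he₁]; linarith
  simp only [Nat.reduceMul]
  rw [s₁, s₂, q, ← hp₂, ← hp₄, ← he₅, hy₁]
  clear hp₁ hp₂ hp₃ hp₄ he₁ he₂ he₃ he₄ he₅ s₁ s₂ q hy hy₁
  subst n₁
  subst n₂
  subst n₃
  subst n₄
  ring

/-- The invariant of degree 5 given by `formulaE₆`. -/
noncomputable def invariantE₆ (e : Fin 5 → EucSpace n) (U : EucSpace n) :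
    MvPolynomial (Fin n) ℝ :=
  MvPolynomial.C (3) * (linearForm U ^ 5) +
    MvPolynomial.C (-2) * (linearForm U ^ 3 * evenPowerSum e 1) +
    MvPolynomial.C (1) * (linearForm U * evenPowerSum e 1 * evenPowerSum e 1) +
    MvPolynomial.C (-2) * (linearForm U * evenPowerSum e 2) +
    MvPolynomial.C (8) * (prodForm e)

theorem totalDegree_invariantE₆_le (e : Fin 5 → EucSpace n) (U : EucSpace n) :
    (invariantE₆ e U).totalDegree ≤ 5 := by
  have hY := isHomogeneous_linearForm U
  have hS := isHomogeneous_evenPowerSum e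
  have hP := isHomogeneous_prodForm e
  refine MvPolynomial.IsHomogeneous.totalDegree_le ?_
  unfold invariantE₆
  have h0 := (hY.pow 5).C_mul (3 : ℝ)
  have h1 := ((hY.pow 3).mul (hS 1)).C_mul (-2 : ℝ)
  have h2 := (((hY).mul (hS 1)).mul (hS 1)).C_mul (1 : ℝ)
  have h3 := ((hY).mul (hS 2)).C_mul (-2 : ℝ)
  have h4 := (hP).C_mul (8 : ℝ)
  exact (((h0.add h1).add h2).add h3).add h4

theorem evalAt_invariantE₆ (e : Fin 5 → EucSpace n) (U p : EucSpace n) :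
    evalAt p (invariantE₆ e U) = formulaE₆ (fun k => ∑ i, IsFrame.coords e p i ^ (2 * k))
      (∏ i, IsFrame.coords e p i) ⟪U, p⟫ := by
  simp only [← evalAt_evenPowerSum, ← evalAt_prodForm, ← evalAt_linearForm]
  simp [evalAt, invariantE₆, formulaE₆]

/-- A formula for an invariant of degree 6 of the group of type `E₇`, in terms of even power sums,
the product of the coordinates, and the last coordinate. -/
def formulaE₇ (s : ℕ → ℝ) (q y : ℝ) : ℝ :=
  16 * (y ^ 4 * s 1) + 40 * (y ^ 2 * s 2) + (-12) * (y ^ 2 * s 1 * s 1) + 8 * (s 3) +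
      (-10) * (s 1 * s 2) + 3 * (s 1 * s 1 * s 1) + (-240) * (q)

theorem formulaE₇_spin (w : Fin 6 → ℝ) (y τ : ℝ) (hy : (2 : ℝ) * y = ∑ i, w i + 4 * τ) :
    formulaE₇ (fun k => ∑ i, (w i + τ) ^ (2 * k)) (∏ i, (w i + τ)) (y - τ) =
      formulaE₇ (fun k => ∑ i, w i ^ (2 * k)) (∏ i, w i) y := by
  simp only [formulaE₇]
  simp only [Fin.sum_univ_six, Fin.prod_univ_six] at hy ⊢
  generalize w 0 = a at *
  generalize w 1 = b at *
  generalize w 2 = c at *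
  generalize w 3 = d at *
  generalize w 4 = f at *
  generalize w 5 = g at *
  obtain ⟨e₁, he₁⟩ : ∃ r, r = a + b + c + d + f + g := ⟨_, rfl⟩
  obtain ⟨e₂, he₂⟩ : ∃ r, r = a * b + a * c + a * d + a * f + a * g + b * c + b * d + b * f +
      b * g + c * d + c * f + c * g + d * f + d * g + f * g := ⟨_, rfl⟩
  obtain ⟨e₃, he₃⟩ : ∃ r, r = a * b * c + a * b * d + a * b * f + a * b * g + a * c * d +
      a * c * f + a * c * g + a * d * f + a * d * g + a * f * g + b * c * d + b * c * f +
      b * c * g + b * d * f + b * d * g + b * f * g + c * d * f + c * d * g + c * f * g +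
      d * f * g := ⟨_, rfl⟩
  obtain ⟨e₄, he₄⟩ : ∃ r, r = a * b * c * d + a * b * c * f + a * b * c * g + a * b * d * f +
      a * b * d * g + a * b * f * g + a * c * d * f + a * c * d * g + a * c * f * g +
      a * d * f * g + b * c * d * f + b * c * d * g + b * c * f * g + b * d * f * g +
      c * d * f * g := ⟨_, rfl⟩
  obtain ⟨e₅, he₅⟩ : ∃ r, r = a * b * c * d * f + a * b * c * d * g + a * b * c * f * g +
      a * b * d * f * g + a * c * d * f * g + b * c * d * f * g := ⟨_, rfl⟩
  obtain ⟨e₆, he₆⟩ : ∃ r, r = a * b * c * d * f * g := ⟨_, rfl⟩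
  obtain ⟨p₁, hp₁⟩ : ∃ r, r = a ^ 1 + b ^ 1 + c ^ 1 + d ^ 1 + f ^ 1 + g ^ 1 := ⟨_, rfl⟩
  obtain ⟨p₂, hp₂⟩ : ∃ r, r = a ^ 2 + b ^ 2 + c ^ 2 + d ^ 2 + f ^ 2 + g ^ 2 := ⟨_, rfl⟩
  obtain ⟨p₃, hp₃⟩ : ∃ r, r = a ^ 3 + b ^ 3 + c ^ 3 + d ^ 3 + f ^ 3 + g ^ 3 := ⟨_, rfl⟩
  obtain ⟨p₄, hp₄⟩ : ∃ r, r = a ^ 4 + b ^ 4 + c ^ 4 + d ^ 4 + f ^ 4 + g ^ 4 := ⟨_, rfl⟩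
  obtain ⟨p₅, hp₅⟩ : ∃ r, r = a ^ 5 + b ^ 5 + c ^ 5 + d ^ 5 + f ^ 5 + g ^ 5 := ⟨_, rfl⟩
  obtain ⟨p₆, hp₆⟩ : ∃ r, r = a ^ 6 + b ^ 6 + c ^ 6 + d ^ 6 + f ^ 6 + g ^ 6 := ⟨_, rfl⟩
  have n₁ : p₁ = 1 * e₁ := by
    rw [hp₁, he₁]; ring
  have n₂ : p₂ = e₁ * p₁ - 2 * e₂ := by
    rw [hp₁, hp₂, he₁, he₂]; ring
  have n₃ : p₃ = e₁ * p₂ - e₂ * p₁ + 3 * e₃ := by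
    rw [hp₁, hp₂, hp₃, he₁, he₂, he₃]; ring
  have n₄ : p₄ = e₁ * p₃ - e₂ * p₂ + e₃ * p₁ - 4 * e₄ := by
    rw [hp₁, hp₂, hp₃, hp₄, he₁, he₂, he₃, he₄]; ring
  have n₅ : p₅ = e₁ * p₄ - e₂ * p₃ + e₃ * p₂ - e₄ * p₁ + 5 * e₅ := by
    rw [hp₁, hp₂, hp₃, hp₄, hp₅, he₁, he₂, he₃, he₄, he₅]; ring
  have n₆ : p₆ = e₁ * p₅ - e₂ * p₄ + e₃ * p₃ - e₄ * p₂ + e₅ * p₁ - 6 * e₆ := by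
    rw [hp₁, hp₂, hp₃, hp₄, hp₅, hp₆, he₁, he₂, he₃, he₄, he₅, he₆]; ring
  have s₁ : (a + τ) ^ 2 + (b + τ) ^ 2 + (c + τ) ^ 2 + (d + τ) ^ 2 + (f + τ) ^ 2 + (g +
      τ) ^ 2 = p₂ + 2 * τ ^ 1 * p₁ + 1 * τ ^ 2 * 6 := by
    rw [hp₁, hp₂]; ring
  have s₂ : (a + τ) ^ 4 + (b + τ) ^ 4 + (c + τ) ^ 4 + (d + τ) ^ 4 + (f + τ) ^ 4 + (g +
      τ) ^ 4 = p₄ + 4 * τ ^ 1 * p₃ + 6 * τ ^ 2 * p₂ + 4 * τ ^ 3 * p₁ + 1 * τ ^ 4 * 6 := by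
    rw [hp₁, hp₂, hp₃, hp₄]; ring
  have s₃ : (a + τ) ^ 6 + (b + τ) ^ 6 + (c + τ) ^ 6 + (d + τ) ^ 6 + (f + τ) ^ 6 + (g +
      τ) ^ 6 = p₆ + 6 * τ ^ 1 * p₅ + 15 * τ ^ 2 * p₄ + 20 * τ ^ 3 * p₃ + 15 * τ ^ 4 * p₂ +
      6 * τ ^ 5 * p₁ + 1 * τ ^ 6 * 6 := by
    rw [hp₁, hp₂, hp₃, hp₄, hp₅, hp₆]; ring
  have q : (a + τ) * (b + τ) * (c + τ) * (d + τ) * (f + τ) * (g + τ) = e₆ + τ ^ 1 * e₅ +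
      τ ^ 2 * e₄ + τ ^ 3 * e₃ + τ ^ 4 * e₂ + τ ^ 5 * e₁ + τ ^ 6 := by
    rw [he₁, he₂, he₃, he₄, he₅, he₆]; ring
  have hy₁ : y = (e₁ + 4 * τ) / 2 := by rw [he₁]; linarith
  simp only [Nat.reduceMul]
  rw [s₁, s₂, s₃, q, ← hp₂, ← hp₄, ← hp₆, ← he₆, hy₁]
  clear hp₁ hp₂ hp₃ hp₄ hp₅ hp₆ he₁ he₂ he₃ he₄ he₅ he₆ s₁ s₂ s₃ q hy hy₁
  subst n₁
  subst n₂
  subst n₃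
  subst n₄
  subst n₅
  subst n₆
  ring

/-- The invariant of degree 6 given by `formulaE₇`. -/
noncomputable def invariantE₇ (e : Fin 6 → EucSpace n) (U : EucSpace n) :
    MvPolynomial (Fin n) ℝ :=
  MvPolynomial.C (16) * (linearForm U ^ 4 * evenPowerSum e 1) +
    MvPolynomial.C (40) * (linearForm U ^ 2 * evenPowerSum e 2) +
    MvPolynomial.C (-12) * (linearForm U ^ 2 * evenPowerSum e 1 * evenPowerSum e 1) +
    MvPolynomial.C (8) * (evenPowerSum e 3) +
    MvPolynomial.C (-10) * (evenPowerSum e 1 * evenPowerSum e 2) +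
    MvPolynomial.C (3) * (evenPowerSum e 1 * evenPowerSum e 1 * evenPowerSum e 1) +
    MvPolynomial.C (-240) * (prodForm e)

theorem totalDegree_invariantE₇_le (e : Fin 6 → EucSpace n) (U : EucSpace n) :
    (invariantE₇ e U).totalDegree ≤ 6 := by
  have hY := isHomogeneous_linearForm U
  have hS := isHomogeneous_evenPowerSum e
  have hP := isHomogeneous_prodForm e
  refine MvPolynomial.IsHomogeneous.totalDegree_le ?_
  unfold invariantE₇
  have h0 := ((hY.pow 4).mul (hS 1)).C_mul (16 : ℝ)
  have h1 := ((hY.pow 2).mul (hS 2)).C_mul (40 : ℝ)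
  have h2 := (((hY.pow 2).mul (hS 1)).mul (hS 1)).C_mul (-12 : ℝ)
  have h3 := (hS 3).C_mul (8 : ℝ)
  have h4 := ((hS 1).mul (hS 2)).C_mul (-10 : ℝ)
  have h5 := (((hS 1).mul (hS 1)).mul (hS 1)).C_mul (3 : ℝ)
  have h6 := (hP).C_mul (-240 : ℝ)
  exact (((((h0.add h1).add h2).add h3).add h4).add h5).add h6

theorem evalAt_invariantE₇ (e : Fin 6 → EucSpace n) (U p : EucSpace n) :
    evalAt p (invariantE₇ e U) = formulaE₇ (fun k => ∑ i, IsFrame.coords e p i ^ (2 * k))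
      (∏ i, IsFrame.coords e p i) ⟪U, p⟫ := by
  simp only [← evalAt_evenPowerSum, ← evalAt_prodForm, ← evalAt_linearForm]
  simp [evalAt, invariantE₇, formulaE₇]

/-- A formula for an invariant of degree 8 of the group of type `E₈`, in terms of even power sums,
the product of the coordinates, and the last coordinate. -/
def formulaE₈ (s : ℕ → ℝ) (q y : ℝ) : ℝ :=
  2 * (y ^ 6 * s 1) + (-11) * (y ^ 4 * s 1 * s 1) + 35 * (y ^ 4 * s 2) +
      16 * (y ^ 2 * s 1 * s 1 * s 1) + (-70) * (y ^ 2 * s 1 * s 2) + 56 * (y ^ 2 * s 3) +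
      (-3360) * (y * q) + 4 * (s 1 * s 1 * s 1 * s 1) + (-35) * (s 1 * s 1 * s 2) +
      56 * (s 1 * s 3) + 35 * (s 2 * s 2) + (-60) * (s 4)

theorem formulaE₈_spin (w : Fin 7 → ℝ) (y τ : ℝ) (hy : (1 : ℝ) * y = ∑ i, w i + 4 * τ) :
    formulaE₈ (fun k => ∑ i, (w i + τ) ^ (2 * k)) (∏ i, (w i + τ)) (y - τ) =
      formulaE₈ (fun k => ∑ i, w i ^ (2 * k)) (∏ i, w i) y := by
  simp only [formulaE₈]
  simp only [Fin.sum_univ_seven, Fin.prod_univ_seven] at hy ⊢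
  generalize w 0 = a at *
  generalize w 1 = b at *
  generalize w 2 = c at *
  generalize w 3 = d at *
  generalize w 4 = f at *
  generalize w 5 = g at *
  generalize w 6 = h at *
  obtain ⟨e₁, he₁⟩ : ∃ r, r = a + b + c + d + f + g + h := ⟨_, rfl⟩
  obtain ⟨e₂, he₂⟩ : ∃ r, r = a * b + a * c + a * d + a * f + a * g + a * h + b * c + b * d +
      b * f + b * g + b * h + c * d + c * f + c * g + c * h + d * f + d * g + d * h + f * g +
      f * h + g * h := ⟨_, rfl⟩
  obtain ⟨e₃, he₃⟩ : ∃ r, r = a * b * c + a * b * d + a * b * f + a * b * g + a * b * h +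
      a * c * d + a * c * f + a * c * g + a * c * h + a * d * f + a * d * g + a * d * h +
      a * f * g + a * f * h + a * g * h + b * c * d + b * c * f + b * c * g + b * c * h +
      b * d * f + b * d * g + b * d * h + b * f * g + b * f * h + b * g * h + c * d * f +
      c * d * g + c * d * h + c * f * g + c * f * h + c * g * h + d * f * g + d * f * h +
      d * g * h + f * g * h := ⟨_, rfl⟩
  obtain ⟨e₄, he₄⟩ : ∃ r, r = a * b * c * d + a * b * c * f + a * b * c * g + a * b * c * h +
      a * b * d * f + a * b * d * g + a * b * d * h + a * b * f * g + a * b * f * h +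
      a * b * g * h + a * c * d * f + a * c * d * g + a * c * d * h + a * c * f * g +
      a * c * f * h + a * c * g * h + a * d * f * g + a * d * f * h + a * d * g * h +
      a * f * g * h + b * c * d * f + b * c * d * g + b * c * d * h + b * c * f * g +
      b * c * f * h + b * c * g * h + b * d * f * g + b * d * f * h + b * d * g * h +
      b * f * g * h + c * d * f * g + c * d * f * h + c * d * g * h + c * f * g * h +
      d * f * g * h := ⟨_, rfl⟩
  obtain ⟨e₅, he₅⟩ : ∃ r, r = a * b * c * d * f + a * b * c * d * g + a * b * c * d * h +
      a * b * c * f * g + a * b * c * f * h + a * b * c * g * h + a * b * d * f * g +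
      a * b * d * f * h + a * b * d * g * h + a * b * f * g * h + a * c * d * f * g +
      a * c * d * f * h + a * c * d * g * h + a * c * f * g * h + a * d * f * g * h +
      b * c * d * f * g + b * c * d * f * h + b * c * d * g * h + b * c * f * g * h +
      b * d * f * g * h + c * d * f * g * h := ⟨_, rfl⟩
  obtain ⟨e₆, he₆⟩ : ∃ r, r = a * b * c * d * f * g + a * b * c * d * f * h +
      a * b * c * d * g * h + a * b * c * f * g * h + a * b * d * f * g * h +
      a * c * d * f * g * h + b * c * d * f * g * h := ⟨_, rfl⟩
  obtain ⟨e₇, he₇⟩ : ∃ r, r = a * b * c * d * f * g * h := ⟨_, rfl⟩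
  obtain ⟨p₁, hp₁⟩ : ∃ r, r = a ^ 1 + b ^ 1 + c ^ 1 + d ^ 1 + f ^ 1 + g ^ 1 + h ^ 1 := ⟨_, rfl⟩
  obtain ⟨p₂, hp₂⟩ : ∃ r, r = a ^ 2 + b ^ 2 + c ^ 2 + d ^ 2 + f ^ 2 + g ^ 2 + h ^ 2 := ⟨_, rfl⟩
  obtain ⟨p₃, hp₃⟩ : ∃ r, r = a ^ 3 + b ^ 3 + c ^ 3 + d ^ 3 + f ^ 3 + g ^ 3 + h ^ 3 := ⟨_, rfl⟩
  obtain ⟨p₄, hp₄⟩ : ∃ r, r = a ^ 4 + b ^ 4 + c ^ 4 + d ^ 4 + f ^ 4 + g ^ 4 + h ^ 4 := ⟨_, rfl⟩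
  obtain ⟨p₅, hp₅⟩ : ∃ r, r = a ^ 5 + b ^ 5 + c ^ 5 + d ^ 5 + f ^ 5 + g ^ 5 + h ^ 5 := ⟨_, rfl⟩
  obtain ⟨p₆, hp₆⟩ : ∃ r, r = a ^ 6 + b ^ 6 + c ^ 6 + d ^ 6 + f ^ 6 + g ^ 6 + h ^ 6 := ⟨_, rfl⟩
  obtain ⟨p₇, hp₇⟩ : ∃ r, r = a ^ 7 + b ^ 7 + c ^ 7 + d ^ 7 + f ^ 7 + g ^ 7 + h ^ 7 := ⟨_, rfl⟩
  obtain ⟨p₈, hp₈⟩ : ∃ r, r = a ^ 8 + b ^ 8 + c ^ 8 + d ^ 8 + f ^ 8 + g ^ 8 + h ^ 8 := ⟨_, rfl⟩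
  have n₁ : p₁ = 1 * e₁ := by
    rw [hp₁, he₁]; ring
  have n₂ : p₂ = e₁ * p₁ - 2 * e₂ := by
    rw [hp₁, hp₂, he₁, he₂]; ring
  have n₃ : p₃ = e₁ * p₂ - e₂ * p₁ + 3 * e₃ := by
    rw [hp₁, hp₂, hp₃, he₁, he₂, he₃]; ring
  have n₄ : p₄ = e₁ * p₃ - e₂ * p₂ + e₃ * p₁ - 4 * e₄ := by
    rw [hp₁, hp₂, hp₃, hp₄, he₁, he₂, he₃, he₄]; ring
  have n₅ : p₅ = e₁ * p₄ - e₂ * p₃ + e₃ * p₂ - e₄ * p₁ + 5 * e₅ := by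
    rw [hp₁, hp₂, hp₃, hp₄, hp₅, he₁, he₂, he₃, he₄, he₅]; ring
  have n₆ : p₆ = e₁ * p₅ - e₂ * p₄ + e₃ * p₃ - e₄ * p₂ + e₅ * p₁ - 6 * e₆ := by
    rw [hp₁, hp₂, hp₃, hp₄, hp₅, hp₆, he₁, he₂, he₃, he₄, he₅, he₆]; ring
  have n₇ : p₇ = e₁ * p₆ - e₂ * p₅ + e₃ * p₄ - e₄ * p₃ + e₅ * p₂ - e₆ * p₁ + 7 * e₇ := by
    rw [hp₁, hp₂, hp₃, hp₄, hp₅, hp₆, hp₇, he₁, he₂, he₃, he₄, he₅, he₆, he₇]; ring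
  -- With seven variables there is no eighth elementary symmetric function, so Newton's identity has
  -- no last term.
  have n₈ : p₈ = e₁ * p₇ - e₂ * p₆ + e₃ * p₅ - e₄ * p₄ + e₅ * p₃ - e₆ * p₂ + e₇ * p₁ := by
    rw [hp₁, hp₂, hp₃, hp₄, hp₅, hp₆, hp₇, hp₈, he₁, he₂, he₃, he₄, he₅, he₆, he₇]; ring
  have s₁ : (a + τ) ^ 2 + (b + τ) ^ 2 + (c + τ) ^ 2 + (d + τ) ^ 2 + (f + τ) ^ 2 + (g + τ) ^ 2 +
      (h + τ) ^ 2 = p₂ + 2 * τ ^ 1 * p₁ + 1 * τ ^ 2 * 7 := by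
    rw [hp₁, hp₂]; ring
  have s₂ : (a + τ) ^ 4 + (b + τ) ^ 4 + (c + τ) ^ 4 + (d + τ) ^ 4 + (f + τ) ^ 4 + (g + τ) ^ 4 +
      (h + τ) ^ 4 = p₄ + 4 * τ ^ 1 * p₃ + 6 * τ ^ 2 * p₂ + 4 * τ ^ 3 * p₁ + 1 * τ ^ 4 * 7 := by
    rw [hp₁, hp₂, hp₃, hp₄]; ring
  have s₃ : (a + τ) ^ 6 + (b + τ) ^ 6 + (c + τ) ^ 6 + (d + τ) ^ 6 + (f + τ) ^ 6 + (g + τ) ^ 6 +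
      (h + τ) ^ 6 = p₆ + 6 * τ ^ 1 * p₅ + 15 * τ ^ 2 * p₄ + 20 * τ ^ 3 * p₃ + 15 * τ ^ 4 * p₂ +
      6 * τ ^ 5 * p₁ + 1 * τ ^ 6 * 7 := by
    rw [hp₁, hp₂, hp₃, hp₄, hp₅, hp₆]; ring
  have s₄ : (a + τ) ^ 8 + (b + τ) ^ 8 + (c + τ) ^ 8 + (d + τ) ^ 8 + (f + τ) ^ 8 + (g + τ) ^ 8 +
      (h + τ) ^ 8 = p₈ + 8 * τ ^ 1 * p₇ + 28 * τ ^ 2 * p₆ + 56 * τ ^ 3 * p₅ + 70 * τ ^ 4 * p₄ +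
      56 * τ ^ 5 * p₃ + 28 * τ ^ 6 * p₂ + 8 * τ ^ 7 * p₁ + 1 * τ ^ 8 * 7 := by
    rw [hp₁, hp₂, hp₃, hp₄, hp₅, hp₆, hp₇, hp₈]; ring
  have q : (a + τ) * (b + τ) * (c + τ) * (d + τ) * (f + τ) * (g + τ) * (h + τ) = e₇ +
      τ ^ 1 * e₆ + τ ^ 2 * e₅ + τ ^ 3 * e₄ + τ ^ 4 * e₃ + τ ^ 5 * e₂ + τ ^ 6 * e₁ + τ ^ 7 := by
    rw [he₁, he₂, he₃, he₄, he₅, he₆, he₇]; ring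
  have hy₁ : y = (e₁ + 4 * τ) / 1 := by rw [he₁]; linarith
  simp only [Nat.reduceMul]
  rw [s₁, s₂, s₃, s₄, q, ← hp₂, ← hp₄, ← hp₆, ← hp₈, ← he₇, hy₁]
  clear hp₁ hp₂ hp₃ hp₄ hp₅ hp₆ hp₇ hp₈ he₁ he₂ he₃ he₄ he₅ he₆ he₇ s₁ s₂ s₃ s₄ q hy hy₁
  subst n₁
  subst n₂
  subst n₃
  subst n₄
  subst n₅
  subst n₆
  subst n₇
  subst n₈
  ring

/-- The invariant of degree 8 given by `formulaE₈`. -/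
noncomputable def invariantE₈ (e : Fin 7 → EucSpace n) (U : EucSpace n) :
    MvPolynomial (Fin n) ℝ :=
  MvPolynomial.C (2) * (linearForm U ^ 6 * evenPowerSum e 1) +
    MvPolynomial.C (-11) * (linearForm U ^ 4 * evenPowerSum e 1 * evenPowerSum e 1) +
    MvPolynomial.C (35) * (linearForm U ^ 4 * evenPowerSum e 2) +
    MvPolynomial.C (16) * (linearForm U ^ 2 * evenPowerSum e 1 * evenPowerSum e 1 * evenPowerSum
        e 1) +
    MvPolynomial.C (-70) * (linearForm U ^ 2 * evenPowerSum e 1 * evenPowerSum e 2) +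
    MvPolynomial.C (56) * (linearForm U ^ 2 * evenPowerSum e 3) +
    MvPolynomial.C (-3360) * (linearForm U * prodForm e) +
    MvPolynomial.C (4) * (evenPowerSum e 1 * evenPowerSum e 1 * evenPowerSum e 1 * evenPowerSum e
        1) +
    MvPolynomial.C (-35) * (evenPowerSum e 1 * evenPowerSum e 1 * evenPowerSum e 2) +
    MvPolynomial.C (56) * (evenPowerSum e 1 * evenPowerSum e 3) +
    MvPolynomial.C (35) * (evenPowerSum e 2 * evenPowerSum e 2) +
    MvPolynomial.C (-60) * (evenPowerSum e 4)

theorem totalDegree_invariantE₈_le (e : Fin 7 → EucSpace n) (U : EucSpace n) :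
    (invariantE₈ e U).totalDegree ≤ 8 := by
  have hY := isHomogeneous_linearForm U
  have hS := isHomogeneous_evenPowerSum e
  have hP := isHomogeneous_prodForm e
  refine MvPolynomial.IsHomogeneous.totalDegree_le ?_
  unfold invariantE₈
  have h0 := ((hY.pow 6).mul (hS 1)).C_mul (2 : ℝ)
  have h1 := (((hY.pow 4).mul (hS 1)).mul (hS 1)).C_mul (-11 : ℝ)
  have h2 := ((hY.pow 4).mul (hS 2)).C_mul (35 : ℝ)
  have h3 := ((((hY.pow 2).mul (hS 1)).mul (hS 1)).mul (hS 1)).C_mul (16 : ℝ)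
  have h4 := (((hY.pow 2).mul (hS 1)).mul (hS 2)).C_mul (-70 : ℝ)
  have h5 := ((hY.pow 2).mul (hS 3)).C_mul (56 : ℝ)
  have h6 := ((hY).mul (hP)).C_mul (-3360 : ℝ)
  have h7 := ((((hS 1).mul (hS 1)).mul (hS 1)).mul (hS 1)).C_mul (4 : ℝ)
  have h8 := (((hS 1).mul (hS 1)).mul (hS 2)).C_mul (-35 : ℝ)
  have h9 := ((hS 1).mul (hS 3)).C_mul (56 : ℝ)
  have h10 := ((hS 2).mul (hS 2)).C_mul (35 : ℝ)
  have h11 := (hS 4).C_mul (-60 : ℝ)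
  exact ((((((((((h0.add h1).add h2).add h3).add h4).add h5).add h6).add h7).add h8).add h9).add
      h10).add h11

theorem evalAt_invariantE₈ (e : Fin 7 → EucSpace n) (U p : EucSpace n) :
    evalAt p (invariantE₈ e U) = formulaE₈ (fun k => ∑ i, IsFrame.coords e p i ^ (2 * k))
      (∏ i, IsFrame.coords e p i) ⟪U, p⟫ := by
  simp only [← evalAt_evenPowerSum, ← evalAt_prodForm, ← evalAt_linearForm]
  simp [evalAt, invariantE₈, formulaE₈]

end Invariants

/-! ### Moving a point inside a slice, and the degree bounds. -/

namespace IsFrame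

section Moving

variable {n m : ℕ} {G : Subgroup (OrthGroup n)} {κ : ℝ} {e : Fin m → EucSpace n} {U : EucSpace n}

/-- The point with coordinates `y` in the affine space through `p` spanned by the `e i`. -/
noncomputable def movePoint (e : Fin m → EucSpace n) (p : EucSpace n) (y : Fin m → ℝ) :
    EucSpace n := p + ∑ i, (y i - coords e p i) • e i

theorem movePoint_coords (p : EucSpace n) : movePoint e p (coords e p) = p := by
  simp [movePoint]

theorem coords_movePoint (h : IsFrame G κ e U) (p : EucSpace n) (y : Fin m → ℝ) :
    coords e (movePoint e p y) = y := by
  ext i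
  simp [coords, movePoint, inner_add_right, inner_sum, inner_smul_right, h.inner_e]

theorem movePoint_add_single (p : EucSpace n) (y : Fin m → ℝ) (i j : Fin m) (c d : ℝ) :
    movePoint e p (y + (Pi.single i c + Pi.single j d)) =
      movePoint e p y + (c • e i + d • e j) := by
  have : ∀ l, (y + (Pi.single i c + Pi.single j d) : Fin m → ℝ) l - coords e p l =
      (y l - coords e p l) + ((Pi.single i c : Fin m → ℝ) l + (Pi.single j d : Fin m → ℝ) l) := by
    intro l
    simp only [Pi.add_apply]
    ring
  simp only [movePoint, this, add_smul, Finset.sum_add_distrib, Pi.single_apply, ite_smul,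
    zero_smul, Finset.sum_ite_eq', Finset.mem_univ, if_true, add_assoc]

theorem movePoint_comp_swap (h : IsFrame G κ e U) (p : EucSpace n) (y : Fin m → ℝ) {i j : Fin m}
    (hij : i ≠ j) :
    movePoint e p (y ∘ Equiv.swap i j) = reflectionAlong (e i - e j) (movePoint e p y) := by
  have h1 : y ∘ Equiv.swap i j = y + (Pi.single i (y j - y i) + Pi.single j (y i - y j)) := by
    ext l
    rcases eq_or_ne l i with rfl | hi
    · simp [hij]
    rcases eq_or_ne l j with rfl | hj
    · simp [hi]
    · simp [hi, hj, Equiv.swap_apply_of_ne_of_ne hi hj]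
  have h2 : ∀ l, ⟪e l, movePoint e p y⟫ = y l := congrFun (h.coords_movePoint p y)
  rw [h1, movePoint_add_single, reflectionAlong_apply]
  simp only [inner_sub_left, inner_sub_right, h2, h.inner_e, hij, hij.symm, if_true, if_false]
  match_scalars <;> ring

theorem movePoint_negPair_comp_swap (h : IsFrame G κ e U) (p : EucSpace n) (y : Fin m → ℝ)
    {i j : Fin m} (hij : i ≠ j) :
    movePoint e p (negPair i j (y ∘ Equiv.swap i j)) =
      reflectionAlong (e i + e j) (movePoint e p y) := by
  have h1 : negPair i j (y ∘ Equiv.swap i j) =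
      y + (Pi.single i (-(y j + y i)) + Pi.single j (-(y i + y j))) := by
    ext l
    rcases eq_or_ne l i with rfl | hi
    · simp [hij, negPair]
    rcases eq_or_ne l j with rfl | hj
    · simp [hi, negPair]
    · simp [hi, hj, Equiv.swap_apply_of_ne_of_ne hi hj, negPair]
  have h2 : ∀ l, ⟪e l, movePoint e p y⟫ = y l := congrFun (h.coords_movePoint p y)
  rw [h1, movePoint_add_single, reflectionAlong_apply]
  simp only [inner_add_left, inner_add_right, h2, h.inner_e, hij, hij.symm, if_true, if_false]
  match_scalars <;> ring

/-- A polynomial on `ℝⁿ` restricted to the affine space through `p` spanned by the `e i`. -/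
noncomputable def slicePoly (e : Fin m → EucSpace n) (p : EucSpace n)
    (f : MvPolynomial (Fin n) ℝ) : MvPolynomial (Fin m) ℝ :=
  MvPolynomial.aeval (fun j => MvPolynomial.C (p j) +
    ∑ i, MvPolynomial.C (e i j) * (MvPolynomial.X i - MvPolynomial.C (coords e p i))) f

theorem eval_slicePoly (p : EucSpace n) (f : MvPolynomial (Fin n) ℝ) (y : Fin m → ℝ) :
    MvPolynomial.eval y (slicePoly e p f) = evalAt (movePoint e p y) f := by
  have h : (MvPolynomial.eval y).comp (MvPolynomial.aeval (R := ℝ) (fun j : Fin n =>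
      MvPolynomial.C (p j) + ∑ i, MvPolynomial.C (e i j) *
        (MvPolynomial.X i - MvPolynomial.C (coords e p i)))).toRingHom =
      MvPolynomial.eval fun j => movePoint e p y j := by
    refine MvPolynomial.ringHom_ext (fun r => by simp) fun j => ?_
    simp [movePoint, mul_comm]
  exact congrArg (fun φ : MvPolynomial (Fin n) ℝ →+* ℝ => φ f) h

theorem totalDegree_slicePoly_le (p : EucSpace n) (f : MvPolynomial (Fin n) ℝ) :
    (slicePoly e p f).totalDegree ≤ f.totalDegree := by
  refine totalDegree_aeval_le_of_affine f fun j => ?_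
  refine (MvPolynomial.totalDegree_add _ _).trans (max_le ?_ ?_)
  · simp
  · refine MvPolynomial.totalDegree_finsetSum_le fun i _ => ?_
    refine (MvPolynomial.totalDegree_mul _ _).trans ?_
    rw [MvPolynomial.totalDegree_C, zero_add]
    refine (MvPolynomial.totalDegree_sub _ _).trans (max_le ?_ ?_)
    · rw [MvPolynomial.totalDegree_X]
    · simp

/-- Invariants of degree at most `2 * k + 1` do not change along a slice as long as the first `k`
even power sums and the product of the coordinates are constant. -/
theorem evalAt_movePoint_eq (h : IsFrame G κ e U) (hm : 2 ≤ m) {k : ℕ}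
    {f : MvPolynomial (Fin n) ℝ} (hf : f ∈ invariantRing G) (hdeg : f.totalDegree ≤ 2 * k + 1)
    (p : EucSpace n) {z : Fin m → ℝ}
    (hz : ∀ i, 1 ≤ i → i ≤ k → ∑ l, z l ^ (2 * i) = ∑ l, coords e p l ^ (2 * i))
    (hz' : ∏ l, z l = ∏ l, coords e p l) : evalAt (movePoint e p z) f = evalAt p f := by
  have hswap : ∀ i j, i ≠ j → ∀ y, MvPolynomial.eval (y ∘ Equiv.swap i j) (slicePoly e p f) =
      MvPolynomial.eval y (slicePoly e p f) := by
    intro i j hij y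
    rw [eval_slicePoly, eval_slicePoly, h.movePoint_comp_swap p y hij]
    exact hf _ (h.reflectionAlong_sub_mem hij) _
  have hneg : ∀ i j, i ≠ j → ∀ y, MvPolynomial.eval (negPair i j y) (slicePoly e p f) =
      MvPolynomial.eval y (slicePoly e p f) := by
    intro i j hij y
    -- The reflection in `e i + e j` swaps two coordinates and negates both; undoing the swap leaves
    -- the pure sign change.
    have hy : y = (y ∘ Equiv.swap i j) ∘ Equiv.swap i j := by
      ext l
      simp
    rw [← hswap i j hij y]
    conv_lhs => rw [hy]
    rw [eval_slicePoly, eval_slicePoly, h.movePoint_negPair_comp_swap p _ hij]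
    exact hf _ (h.reflectionAlong_add_mem hm hij) _
  have : Nonempty (Fin m) := ⟨⟨0, by omega⟩⟩
  have := eval_eq_of_evenSign_invariant hswap hneg
    ((totalDegree_slicePoly_le p f).trans hdeg) hz hz'
  rwa [eval_slicePoly, eval_slicePoly, movePoint_coords] at this

theorem exists_root (h : IsFrame G κ e U) (hm : 2 ≤ m) {i j : Fin m} (hij : i ≠ j) {ε : ℝ}
    (hε : ε = 1 ∨ ε = -1) :
    hyperplaneOf (e i + ε • e j) ∈ reflectionArrangement G := by
  refine ⟨_, fun h0 => ?_, ?_, rfl⟩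
  · have h1 : ⟪e i, e i + ε • e j⟫ = 0 := by rw [h0, inner_zero_right]
    rw [inner_add_right, inner_smul_right, h.inner_e, h.inner_e, if_pos rfl, if_neg hij] at h1
    norm_num at h1
  · rcases hε with rfl | rfl
    · rw [one_smul]
      exact h.reflectionAlong_add_mem hm hij
    · rw [neg_one_smul, ← sub_eq_add_neg]
      exact h.reflectionAlong_sub_mem hij

theorem mem_stratum (h : IsFrame G κ e U) (hm : 2 ≤ m) {q : EucSpace n}
    (hq : IsCodimTwo (coords e q)) : q ∈ stratum G (n - 2) := by
  obtain ⟨i, j, i', j', ε, ε', hij, hij', hε, hε', h1, h2, hdep⟩ := hq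
  set r := e i + ε • e j with hr
  set r' := e i' + ε' • e j' with hr'
  have hε0 : ε ≠ 0 := by rcases hε with rfl | rfl <;> norm_num
  have hli : LinearIndependent ℝ ![r, r'] := by
    rw [LinearIndependent.pair_iff]
    intro s t hst
    have hin : ∀ l, s * ((if l = i then 1 else 0) + ε * (if l = j then 1 else 0)) +
        t * ((if l = i' then 1 else 0) + ε' * (if l = j' then 1 else 0)) = 0 := by
      intro l
      have := congrArg (fun v => ⟪e l, v⟫) hst
      simpa only [hr, hr', inner_add_right, inner_smul_right, h.inner_e,
          inner_zero_right] using this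
    -- Either `e j` occurs only in `r`, or both roots live on the same pair with opposite signs, a
    -- system with determinant `ε' - ε`, up to sign.
    rcases hdep with ⟨hj1, hj2⟩ | ⟨rfl, rfl, hεε⟩
    · have hs : s = 0 := by
        have := hin j
        simp only [hij.symm, hj1, hj2, if_true, if_false] at this
        have : s * ε = 0 := by linarith
        exact (mul_eq_zero.mp this).resolve_right hε0
      refine ⟨hs, ?_⟩
      have := hin i'
      simp only [hs, hij', if_true, if_false] at this
      linarith
    · have ha := hin i
      have hb := hin j
      simp only [hij, hij.symm, if_true, if_false] at ha hb
      have hs : s * (ε - ε') = 0 := by linear_combination hb - ε' * ha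
      have hs0 := (mul_eq_zero.mp hs).resolve_right (sub_ne_zero.mpr hεε)
      refine ⟨hs0, ?_⟩
      rw [hs0] at ha
      linarith
  have hperp : hyperplaneOf r ⊓ hyperplaneOf r' = (Submodule.span ℝ (Set.range ![r, r']))ᗮ := by
    rw [Submodule.inf_orthogonal]
    congr 1
    rw [Matrix.range_cons, Matrix.range_cons, Matrix.range_empty, Set.union_empty,
      Submodule.span_union]
  refine ⟨hyperplaneOf r ⊓ hyperplaneOf r', ⟨{hyperplaneOf r, hyperplaneOf r'}, ?_, ?_⟩, ?_, ?_, ?_⟩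
  · rintro _ (rfl | rfl)
    · exact h.exists_root hm hij hε
    · exact h.exists_root hm hij' hε'
  · rw [sInf_pair]
  · have h3 := Submodule.finrank_add_finrank_orthogonal (Submodule.span ℝ (Set.range ![r, r']))
    rw [finrank_span_eq_card hli, finrank_euclideanSpace_fin, Fintype.card_fin] at h3
    rw [hperp]
    omega
  · rw [SetLike.mem_coe, Submodule.mem_orthogonal_singleton_iff_inner_right, hr, inner_add_left,
      inner_smul_left]
    exact h1
  · rw [SetLike.mem_coe, Submodule.mem_orthogonal_singleton_iff_inner_right, hr', inner_add_left,
      inner_smul_left]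
    exact h2

/-- If the first two basic invariants have degree at most `2 * (n - 4) + 1`, then `2`-sparse
varieties meet the stratum of codimension two. -/
theorem inter_stratum_nonempty (h : IsFrame G κ e U) {k : ℕ} (hk : 1 ≤ k) (hm : m = k + 3)
    (hdeg : ∀ π : Fin n → MvPolynomial (Fin n) ℝ, IsBasicInvariants G π → ∀ i : Fin n,
      (i : ℕ) < 2 → (π i).totalDegree ≤ 2 * k + 1)
    {X : Set (EucSpace n)} (hX : IsSparse G 2 X) (hne : X.Nonempty) :
    (X ∩ stratum G (n - 2)).Nonempty := by
  obtain ⟨π, hπ, N, f, hf, rfl⟩ := hX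
  obtain ⟨p, hp⟩ := hne
  obtain ⟨z, hz, hz', hcod⟩ := exists_isCodimTwo hk (by rw [Fintype.card_fin, hm]) (coords e p)
  have hm2 : 2 ≤ m := by omega
  refine ⟨movePoint e p z, fun j => ?_, h.mem_stratum hm2 (by rwa [h.coords_movePoint])⟩
  have key : ∀ g ∈ Algebra.adjoin ℝ (π '' {i : Fin n | (i : ℕ) < 2}),
      evalAt (movePoint e p z) g = evalAt p g := by
    intro g hg
    induction hg using Algebra.adjoin_induction with
    | mem g hg =>
      obtain ⟨i, hi, rfl⟩ := hg
      refine h.evalAt_movePoint_eq hm2 ?_ (hdeg π hπ i hi) p hz hz'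
      rw [← hπ.adjoin_eq]
      exact Algebra.subset_adjoin ⟨i, rfl⟩
    | algebraMap r => simp [evalAt]
    | add a b _ _ ha hb =>
      simp only [evalAt, map_add] at *
      rw [ha, hb]
    | mul a b _ _ ha hb =>
      simp only [evalAt, map_mul] at *
      rw [ha, hb]
  rw [key _ (hf j)]
  exact hp j

end Moving

section Degrees

variable {n : ℕ} {G : Subgroup (OrthGroup n)}

/-- The invariant has odd degree and does not vanish at `U`, so it separates `U` from `-U`. -/
theorem totalDegree_le_E₆ {e : Fin 5 → EucSpace n} {U : EucSpace n} (h : IsFrame G 3 e U)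
    (hn : 2 ≤ n) {π : Fin n → MvPolynomial (Fin n) ℝ} (hπ : IsBasicInvariants G π) {i : Fin n}
    (hi : (i : ℕ) < 2) : (π i).totalDegree ≤ 5 := by
  refine hπ.totalDegree_le hn (by norm_num) (F := invariantE₆ e U)
    (h.mem_invariantRing (evalAt_invariantE₆ e U) formulaE₆_spin)
    (totalDegree_invariantE₆_le e U) (p := U) (q := -U) (norm_neg U).symm ?_ hi
  rw [evalAt_invariantE₆, evalAt_invariantE₆]
  simp only [formulaE₆, coords, Fin.sum_univ_five, Fin.prod_univ_five, h.inner_eU,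
    inner_neg_right, h.inner_U]
  norm_num

/-- The invariant is zero on the line of `U` but is 1 at `e 0`; the factor `√2` equalizes the norms.
-/
theorem totalDegree_le_E₇ {e : Fin 6 → EucSpace n} {U : EucSpace n} (h : IsFrame G 2 e U)
    (hn : 2 ≤ n) {π : Fin n → MvPolynomial (Fin n) ℝ} (hπ : IsBasicInvariants G π) {i : Fin n}
    (hi : (i : ℕ) < 2) : (π i).totalDegree ≤ 7 := by
  have hnorm : ‖e 0‖ = ‖√2 • U‖ := by
    rw [← sq_eq_sq₀ (norm_nonneg _) (norm_nonneg _), ← real_inner_self_eq_norm_sq,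
      ← real_inner_self_eq_norm_sq, inner_smul_left, inner_smul_right, h.inner_U, h.inner_e,
      conj_trivial, ← mul_assoc, Real.mul_self_sqrt (by norm_num)]
    norm_num
  refine hπ.totalDegree_le hn (by norm_num) (F := invariantE₇ e U)
    (h.mem_invariantRing (evalAt_invariantE₇ e U) formulaE₇_spin)
    ((totalDegree_invariantE₇_le e U).trans (by norm_num)) hnorm ?_ hi
  rw [evalAt_invariantE₇, evalAt_invariantE₇]
  simp only [formulaE₇, coords, Fin.sum_univ_six, Fin.prod_univ_six, inner_smul_right, h.inner_eU,
    h.inner_U_e, h.inner_e]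
  norm_num [Fin.ext_iff]

theorem totalDegree_le_E₈ {e : Fin 7 → EucSpace n} {U : EucSpace n} (h : IsFrame G 1 e U)
    (hn : 2 ≤ n) {π : Fin n → MvPolynomial (Fin n) ℝ} (hπ : IsBasicInvariants G π) {i : Fin n}
    (hi : (i : ℕ) < 2) : (π i).totalDegree ≤ 9 := by
  -- The invariant vanishes at `e 0` as well as on the line of `U`, so a single `e i` would not do;
  -- at `e 0 + e 1` it is 28.
  have hnorm : ‖e 0 + e 1‖ = ‖√2 • U‖ := by
    rw [← sq_eq_sq₀ (norm_nonneg _) (norm_nonneg _), ← real_inner_self_eq_norm_sq,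
      ← real_inner_self_eq_norm_sq, inner_smul_left, inner_smul_right, h.inner_U, conj_trivial,
      ← mul_assoc, Real.mul_self_sqrt (by norm_num)]
    simp only [inner_add_left, inner_add_right, h.inner_e]
    norm_num
  refine hπ.totalDegree_le hn (by norm_num) (F := invariantE₈ e U)
    (h.mem_invariantRing (evalAt_invariantE₈ e U) formulaE₈_spin)
    ((totalDegree_invariantE₈_le e U).trans (by norm_num)) hnorm ?_ hi
  rw [evalAt_invariantE₈, evalAt_invariantE₈]
  simp only [formulaE₈, coords, Fin.sum_univ_seven, Fin.prod_univ_seven, inner_smul_right,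
    inner_add_right, h.inner_eU, h.inner_U_e, h.inner_e]
  norm_num [Fin.ext_iff]

end Degrees

end IsFrame

/-! ### Constructing the frame from the simple roots. -/

section Construction

variable {n m : ℕ}

/-- The entry of the Cartan matrix corresponding to an entry of a simply laced Coxeter matrix. -/
def cartanEntry : ℕ → ℤ
  | 1 => 2
  | 3 => -1
  | _ => 0

theorem neg_two_mul_cos_eq_cartanEntry {N : ℕ} (h : N = 1 ∨ N = 2 ∨ N = 3) :
    2 * -Real.cos (Real.pi / (N : ℝ)) = cartanEntry N := by
  rcases h with rfl | rfl | rfl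
  · simp [cartanEntry]
  · simp [cartanEntry]
  · simp [cartanEntry]

/-- The coordinates of the vectors `2 • e i` of a frame with respect to the simple roots. -/
def frameCoeff (m : ℕ) : Matrix (Fin m) (Fin (m + 1)) ℤ := Matrix.of fun i k =>
  if (k : ℕ) = 0 then 0
  else if (k : ℕ) = 1 then if (i : ℕ) = 0 then -1 else 1
  else if (k : ℕ) = 2 then 1
  else if (k : ℕ) ≤ i + 1 then 2 else 0

/-- The rows of `C` are the coordinates of `2 • e i` in the roots `a`, so orthonormality and the
position of the `D`-roots are integer matrix identities, decidable for a concrete Cartan matrix. The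
root `a 0` plays the spin vector. -/
theorem exists_isFrame {G : Subgroup (OrthGroup n)} {a : Fin (m + 1) → EucSpace n}
    (hm : m < 8) {A : Matrix (Fin (m + 1)) (Fin (m + 1)) ℤ} {C : Matrix (Fin m) (Fin (m + 1)) ℤ}
    (hG : G = Subgroup.closure (Set.range fun l => reflectionAlong (a l)))
    (hA : ∀ i j, ⟪a i, a j⟫ = A i j) (hA0 : A 0 0 = 2)
    (hC : ∀ i j, (C * A * C.transpose) i j = if i = j then 4 else 0)
    (hC0 : ∀ i, (C * A) i 0 = -1)
    (hsub : ∀ i j : Fin m, (j : ℕ) = i + 1 → ∃ l, ∀ k, C j k - C i k = if k = l then 2 else 0)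
    (hadd : ∀ i j : Fin m, (i : ℕ) = 0 → (j : ℕ) = 1 →
      ∃ l, ∀ k, C i k + C j k = if k = l then 2 else 0)
    (hgen : ∀ l : Fin (m + 1), l = 0 ∨ ∃ i j : Fin m, i ≠ j ∧
      ((∀ k, C j k - C i k = if k = l then 2 else 0) ∨
        ∀ k, C i k + C j k = if k = l then 2 else 0)) :
    ∃ (e : Fin m → EucSpace n) (U : EucSpace n), IsFrame G (8 - m) e U := by
  set κ : ℝ := 8 - m with hκ
  have hκ0 : 0 < κ := by
    rw [hκ, sub_pos]
    exact_mod_cast hm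
  set e : Fin m → EucSpace n := fun i => (1 / 2 : ℝ) • ∑ k, (C i k : ℝ) • a k with he
  -- Solved from `a 0 = (κ • U - ∑ i, e i) / 2`.
  set U : EucSpace n := (1 / κ) • ((2 : ℝ) • a 0 + ∑ i, e i) with hU
  have hinner : ∀ i l, ⟪e i, a l⟫ = (1 / 2) * (((C * A) i l : ℤ) : ℝ) := by
    intro i l
    simp only [he, inner_smul_left, sum_inner, hA, Matrix.mul_apply, conj_trivial]
    push_cast
    rfl
  have hee : ∀ i j, ⟪e i, e j⟫ = if i = j then 1 else 0 := by
    intro i j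
    have h1 : ⟪e i, e j⟫ = (1 / 4) * (((C * A * C.transpose) i j : ℤ) : ℝ) := by
      rw [show e j = (1 / 2 : ℝ) • ∑ k, (C j k : ℝ) • a k from rfl, inner_smul_right, inner_sum,
        Matrix.mul_apply]
      push_cast
      rw [Finset.mul_sum, Finset.mul_sum]
      refine Finset.sum_congr rfl fun l _ => ?_
      rw [inner_smul_right, hinner, Matrix.transpose_apply]
      ring
    rw [h1, hC]
    split_ifs <;> norm_num
  have hea : ∀ i, ⟪e i, a 0⟫ = -1 / 2 := by
    intro i
    rw [hinner, hC0]
    norm_num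
  have heU : ∀ i, ⟪e i, U⟫ = 0 := by
    intro i
    simp only [hU, inner_smul_right, inner_add_right, inner_sum, hee, hea, Finset.sum_ite_eq,
      Finset.mem_univ, if_true]
    ring
  have hdiff : ∀ i j l, (∀ k, C j k - C i k = if k = l then 2 else 0) → e j - e i = a l := by
    intro i j l h
    simp only [he]
    rw [← smul_sub, ← Finset.sum_sub_distrib]
    have : ∀ k, (C j k : ℝ) • a k - (C i k : ℝ) • a k = if k = l then (2 : ℝ) • a k else 0 := by
      intro k
      rw [← sub_smul, ← Int.cast_sub, h k]
      split_ifs <;> simp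
    rw [Finset.sum_congr rfl fun k _ => this k, Finset.sum_ite_eq', if_pos (Finset.mem_univ l),
      smul_smul]
    norm_num
  have hsum : ∀ i j l, (∀ k, C i k + C j k = if k = l then 2 else 0) → e i + e j = a l := by
    intro i j l h
    simp only [he]
    rw [← smul_add, ← Finset.sum_add_distrib]
    have : ∀ k, (C i k : ℝ) • a k + (C j k : ℝ) • a k = if k = l then (2 : ℝ) • a k else 0 := by
      intro k
      rw [← add_smul, ← Int.cast_add, h k]
      split_ifs <;> simp
    rw [Finset.sum_congr rfl fun k _ => this k, Finset.sum_ite_eq', if_pos (Finset.mem_univ l),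
      smul_smul]
    norm_num
  have hmem : ∀ l, reflectionAlong (a l) ∈ G := fun l => by
    rw [hG]
    exact Subgroup.subset_closure ⟨l, rfl⟩
  refine ⟨e, U, hκ0, by rw [hκ]; ring, hee, heU, ?_, ?_, ?_, Set.range a, ?_, ?_⟩
  · have hUa : ⟪U, a 0⟫ = (4 - m / 2) / κ := by
      simp only [hU, inner_smul_left, inner_add_left, sum_inner, hea, hA, hA0, conj_trivial]
      simp
      ring
    have hUe : ∀ i, ⟪U, e i⟫ = 0 := fun i => by rw [real_inner_comm, heU]
    have h1 : ⟪U, U⟫ = (1 / κ) * (2 * ⟪U, a 0⟫) := by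
      conv_lhs => rw [hU, inner_smul_right, inner_add_right, inner_smul_right, inner_sum, ← hU]
      simp only [hUe, Finset.sum_const_zero, add_zero]
    rw [h1, hUa]
    field_simp
    rw [hκ]
    ring
  · intro i j hij
    obtain ⟨l, hl⟩ := hsub i j hij
    rw [hdiff i j l hl]
    exact hmem l
  · intro i j hi hj
    obtain ⟨l, hl⟩ := hadd i j hi hj
    rw [hsum i j l hl]
    exact hmem l
  · rw [hG, ← Set.range_comp]
    rfl
  · rintro _ ⟨l, rfl⟩
    rcases hgen l with rfl | ⟨i, j, hij, h | h⟩
    · right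
      rw [hU, smul_smul, mul_one_div_cancel hκ0.ne', one_smul, add_sub_cancel_right, smul_smul]
      norm_num
    · exact .inl ⟨i, j, hij, .inl (hdiff i j l h).symm⟩
    · exact .inl ⟨i, j, hij, .inr (hsum i j l h).symm⟩

theorem exists_isFrame_of_isOfCoxeterType {M : CoxeterMatrix (Fin (m + 1))}
    {G : Subgroup (OrthGroup (m + 1))} (hG : IsOfCoxeterType M G) (hm : m < 8)
    (hM : ∀ i j, M i j = 1 ∨ M i j = 2 ∨ M i j = 3)
    (hC : ∀ i j, (frameCoeff m * (Matrix.of fun i j => cartanEntry (M i j)) *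
      (frameCoeff m).transpose) i j = if i = j then 4 else 0)
    (hC0 : ∀ i, (frameCoeff m * (Matrix.of fun i j => cartanEntry (M i j))) i 0 = -1)
    (hsub : ∀ i j : Fin m, (j : ℕ) = i + 1 →
      ∃ l, ∀ k, frameCoeff m j k - frameCoeff m i k = if k = l then 2 else 0)
    (hadd : ∀ i j : Fin m, (i : ℕ) = 0 → (j : ℕ) = 1 →
      ∃ l, ∀ k, frameCoeff m i k + frameCoeff m j k = if k = l then 2 else 0)
    (hgen : ∀ l : Fin (m + 1), l = 0 ∨ ∃ i j : Fin m, i ≠ j ∧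
      ((∀ k, frameCoeff m j k - frameCoeff m i k = if k = l then 2 else 0) ∨
        ∀ k, frameCoeff m i k + frameCoeff m j k = if k = l then 2 else 0)) :
    ∃ (e : Fin m → EucSpace (m + 1)) (U : EucSpace (m + 1)), IsFrame G (8 - m) e U := by
  obtain ⟨α, -, hα, rfl⟩ := hG
  -- Scaling the unit roots by `√2` turns their Gram matrix into the integral Cartan matrix and
  -- leaves the reflections unchanged.
  refine exists_isFrame (a := fun i => √2 • α i) hm ?_ (fun i j => ?_) ?_ hC hC0 hsub hadd hgen
  · simp only [reflectionAlong_smul (Real.sqrt_ne_zero'.mpr (by norm_num : (0 : ℝ) < 2))]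
  · rw [inner_smul_left, inner_smul_right, conj_trivial, ← mul_assoc,
      Real.mul_self_sqrt (by norm_num), hα, neg_two_mul_cos_eq_cartanEntry (hM i j)]
    rfl
  · rw [Matrix.of_apply, M.diagonal]
    rfl

end Construction

/-! ### The three types and the conclusion. -/

set_option maxRecDepth 100000 in
theorem exists_isFrame_E₆ {G : Subgroup (OrthGroup 6)} (hG : IsTypeE G) :
    ∃ (e : Fin 5 → EucSpace 6) (U : EucSpace 6), IsFrame G 3 e U := by
  obtain ⟨e, U, h⟩ := exists_isFrame_of_isOfCoxeterType (m := 5) hG (by norm_num)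
    (by intro i j; fin_cases i <;> fin_cases j <;> simp [CoxeterMatrix.E₆])
    (by decide) (by decide) (by decide) (by decide) (by decide)
  norm_num at h
  exact ⟨e, U, h⟩

set_option maxRecDepth 100000 in
theorem exists_isFrame_E₇ {G : Subgroup (OrthGroup 7)} (hG : IsTypeE G) :
    ∃ (e : Fin 6 → EucSpace 7) (U : EucSpace 7), IsFrame G 2 e U := by
  obtain ⟨e, U, h⟩ := exists_isFrame_of_isOfCoxeterType (m := 6) hG (by norm_num)
    (by intro i j; fin_cases i <;> fin_cases j <;> simp [CoxeterMatrix.E₇])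
    (by decide) (by decide) (by decide) (by decide) (by decide)
  norm_num at h
  exact ⟨e, U, h⟩

set_option maxRecDepth 100000 in
theorem exists_isFrame_E₈ {G : Subgroup (OrthGroup 8)} (hG : IsTypeE G) :
    ∃ (e : Fin 7 → EucSpace 8) (U : EucSpace 8), IsFrame G 1 e U := by
  obtain ⟨e, U, h⟩ := exists_isFrame_of_isOfCoxeterType (m := 7) hG (by norm_num)
    (by intro i j; fin_cases i <;> fin_cases j <;> simp [CoxeterMatrix.E₈])
    (by decide) (by decide) (by decide) (by decide) (by decide)
  norm_num at h
  exact ⟨e, U, h⟩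

theorem proposition4p1 (n : ℕ) (hn : 6 ≤ n) (hn' : n ≤ 8)
    (G : Subgroup (OrthGroup n)) (hG : IsTypeE G)
    (X : Set (EucSpace n)) (hX : IsSparse G 2 X) (hne : X.Nonempty) :
    (X ∩ stratum G (n - 2)).Nonempty := by
  -- In each case `k = n - 4`, so `2 * k + 1` is 5, 7, 9, against explicit invariants of degree 5,
  -- 6, 8.
  interval_cases n
  · obtain ⟨e, U, h⟩ := exists_isFrame_E₆ hG
    exact h.inter_stratum_nonempty (k := 2) (by norm_num) rfl
      (fun π hπ i hi => h.totalDegree_le_E₆ (by norm_num) hπ hi) hX hne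
  · obtain ⟨e, U, h⟩ := exists_isFrame_E₇ hG
    exact h.inter_stratum_nonempty (k := 3) (by norm_num) rfl
      (fun π hπ i hi => h.totalDegree_le_E₇ (by norm_num) hπ hi) hX hne
  · obtain ⟨e, U, h⟩ := exists_isFrame_E₈ hG
    exact h.inter_stratum_nonempty (k := 4) (by norm_num) rfl
      (fun π hπ i hi => h.totalDegree_le_E₈ (by norm_num) hπ hi) hX hne
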